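/- Model. A radio network is a finite connected undirected graph with $n$ nodes (stations) and diameter $D$. Rounds are numbered $0,1,2,\dots$ and are known to all stations. In each round a station transmits or listens; it receives a message iff it listens and exactly one of its neighbours transmits (zero and several transmitting neighbours cannot be distinguished). Stations are identical, know $n$ but not the graph, and have independent random sources. Initially only one station, the originator, has the message; a station without the message does not transmit. $\log$ is the logarithm to base $2$. Algorithm $\mathrm{GGB}(\varphi,\varepsilon)$. Let $a=\left\lceil\frac{\varphi\log n}{\log n-\varphi\log\varphi}\right\rceil$, $k=24\lceil n^{1/\varphi}\rceil+1$, $t_{ph}=ak$ and $R=\max\left\{0,\left\lceil\varphi\left(1+\frac{\log(2/\varepsilon)}{\log n}\right)\right\rceil\right\}$ (the maximum matters only for $\varepsilon>2n$). Once it has the message, a station performs the following $R$ times and then terminates: wait until the round number is divisible by $t_{ph}$; draw $x\in\{1,2,\dots\}$ from the geometric distribution with $\Pr(x>i)=(\varphi/n^{1/\varphi})^i$ for all integers $i\ge 0$; skip $(\min\{x,a\}-1)k$ rounds; during the next $k$ rounds transmit exactly once, in a round chosen uniformly at random. All random choices are independent. Theorem. There is an absolute constant $C>0$ such that for every $n\ge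 4$, all real $\varphi,\varepsilon$ with $1\le\varphi<\frac{\log n}{\log\log n}$ and $\varepsilon>2n^{-3}$, every connected graph with $n$ nodes and diameter $D$, and every originator: 1. in every execution of $\mathrm{GGB}(\varphi,\varepsilon)$ each station transmits in at most $R$ rounds; 2. with probability at least $1-\varepsilon$, within time $$C\,(D+\varphi)\,n^{1/\varphi}\,\frac{\varphi\log n}{\log n-\varphi\log\varphi}$$ all stations have received the message and terminated; 3. if moreover $\varphi\le\frac{\log n}{2\log\log n}$, then with probability at least $1-\varepsilon$ all stations have received the message and terminated within time $C\,(D+\varphi)\,n^{1/\varphi}\,\varphi$. -/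

import Mathlib

open MeasureTheory ProbabilityTheory

/-! ### Radio networks without collision detection -/

/-- A randomized protocol for single-message broadcast, executed identically by all stations.
It only describes the behaviour of a station that already possesses the message: a station without
the message never transmits. Stations carry no label and know nothing about the graph.
`Seed` is the type of outcomes of the private random source of a station. -/
structure BroadcastProtocol (Seed : Type) where
  /-- local states of a station that possesses the message -/
  State : Type
  /-- the state in which a station begins the first round in which it possesses the message -/
  start : State
  /-- whether a station in the given state at the beginning of round `t` transmits in round `t` -/
  transmits : Seed → (t : ℕ) → State → Prop
  /-- the state at the beginning of round `t + 1`; the argument `heard` tells whether the station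
  received a message in round `t`, which is all the feedback that it gets from the channel -/
  next : Seed → (t : ℕ) → (heard : Prop) → State → State
  /-- the states in which the station has terminated -/
  halted : State → Prop

namespace BroadcastProtocol

variable {Seed : Type} {V : Type*}

/-- A configuration of the network: `none` for a station that does not have the message,
and the local state for a station that has it. -/
abbrev Config (P : BroadcastProtocol Seed) (V : Type*) : Type _ := V → Option P.State

/-- Station `v` transmits in round `t`, when `c` is the configuration at its beginning. -/
def Transmits (P : BroadcastProtocol Seed) (ω : V → Seed) (t : ℕ) (c : P.Config V) (v : V) :
    Prop :=
  ∃ s, c v = some s ∧ P.transmits (ω v) t s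

/-- Station `v` receives a message in round `t`: it listens and exactly one of its neighbours
transmits. -/
def Receives (P : BroadcastProtocol Seed) (G : SimpleGraph V) (ω : V → Seed) (t : ℕ)
    (c : P.Config V) (v : V) : Prop :=
  ¬ P.Transmits ω t c v ∧ ∃! u, G.Adj v u ∧ P.Transmits ω t c u

open Classical in
/-- The configuration after round `t`, when `c` is the configuration before round `t`. -/
noncomputable def step (P : BroadcastProtocol Seed) (G : SimpleGraph V) (ω : V → Seed) (t : ℕ)
    (c : P.Config V) : P.Config V := fun v =>
  match c v with
  | none => if P.Receives G ω t c v then some P.start else none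
  | some s => some (P.next (ω v) t (P.Receives G ω t c v) s)

open Classical in
/-- The configuration at the beginning of round `t` (rounds are numbered `0, 1, 2, …`), that is
after `t` rounds, when only the originator `o` possesses the message initially. -/
noncomputable def config (P : BroadcastProtocol Seed) (G : SimpleGraph V) (o : V) (ω : V → Seed) :
    ℕ → P.Config V
  | 0 => fun v => if v = o then some P.start else none
  | t + 1 => P.step G ω t (P.config G o ω t)

/-- The energetic effort of station `v`: the number of rounds in which it transmits. -/
noncomputable def energy (P : BroadcastProtocol Seed) (G : SimpleGraph V) (o : V) (ω : V → Seed)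
    (v : V) : ℕ∞ :=
  {t : ℕ | P.Transmits ω t (P.config G o ω t) v}.encard

/-- After `t` rounds every station has received the message and has terminated. -/
def CompletedBy (P : BroadcastProtocol Seed) (G : SimpleGraph V) (o : V) (ω : V → Seed)
    (t : ℕ) : Prop :=
  ∀ v, ∃ s, P.config G o ω t v = some s ∧ P.halted s

/-- Every station receives the message and terminates within time `T` (a real number). -/
def CompletesWithin (P : BroadcastProtocol Seed) (G : SimpleGraph V) (o : V) (ω : V → Seed)
    (T : ℝ) : Prop :=
  ∃ t : ℕ, (t : ℝ) ≤ T ∧ P.CompletedBy G o ω t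

end BroadcastProtocol

/-! ### The algorithm Balls-into-Bins Broadcast -/

namespace GGB

/-- The length `a` of a phase, in executions of Balls-into-Bins. -/
noncomputable def a (n : ℕ) (φ : ℝ) : ℕ :=
  ⌈φ * Real.logb 2 n / (Real.logb 2 n - φ * Real.logb 2 φ)⌉₊

/-- The number `k` of time slots (bins) of an execution of Balls-into-Bins. -/
noncomputable def k (n : ℕ) (φ : ℝ) : ℕ :=
  24 * ⌈(n : ℝ) ^ (1 / φ)⌉₊ + 1

/-- The number of rounds of a phase. -/
noncomputable def tph (n : ℕ) (φ : ℝ) : ℕ := a n φ * k n φ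

/-- The number of iterations of the main loop. -/
noncomputable def reps (n : ℕ) (φ ε : ℝ) : ℕ :=
  ⌈φ * (1 + Real.logb 2 (2 / ε) / Real.logb 2 n)⌉₊

/-- The random choices of a station: for each iteration `j`, the number `(ω j).1 + 1 ≥ 1` plays
the role of the geometric variable `x`, and `(ω j).2` is the slot chosen in Balls-into-Bins. -/
abbrev Seed (n : ℕ) (φ ε : ℝ) : Type := Fin (reps n φ ε) → ℕ × Fin (k n φ)

/-- The law of the random choices of a station. They are all independent, the slots are uniform,
and the geometric variable `x` has tail `Pr(x > i) = (φ / n ^ (1 / φ)) ^ i`: Mathlib's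
`geometricMeasure p` is the law of `x - 1`, where `p = 1 - φ / n ^ (1 / φ)` is the probability of
success. -/
noncomputable def seedLaw (n : ℕ) (φ ε : ℝ) : Measure (Seed n φ ε) :=
  Measure.pi fun _ =>
    (geometricMeasure (Set.projIcc (0 : ℝ) 1 zero_le_one (1 - φ / (n : ℝ) ^ (1 / φ)))).prod
      (uniformOn Set.univ)

/-- The law of the random choices of all stations, which are independent. -/
noncomputable def law (V : Type*) [Fintype V] (n : ℕ) (φ ε : ℝ) : Measure (V → Seed n φ ε) :=
  Measure.pi fun _ => seedLaw n φ ε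

/-- Local states of a station that possesses the message; `r` is the number of iterations. -/
inductive State (r : ℕ) : Type
  /-- waiting, before iteration `j`, until the time is divisible by `tph` -/
  | waiting (j : Fin r)
  /-- performing iteration `j`, which started in round `s` -/
  | running (j : Fin r) (s : ℕ)
  /-- all iterations are done -/
  | halted

/-- The state of a station that has performed `j` iterations and is not performing one. -/
def ready (r j : ℕ) : State r := if h : j < r then .waiting ⟨j, h⟩ else .halted

/-- The waiting ends in round `t` if `t` is divisible by `tph`. -/
noncomputable def enter (n : ℕ) (φ ε : ℝ) (t : ℕ) : State (reps n φ ε) → State (reps n φ ε)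
  | .waiting j => if t % tph n φ = 0 then .running j t else .waiting j
  | st => st

/-- The number `min {x, a}` of iteration `j`. -/
noncomputable def bucket {n : ℕ} {φ ε : ℝ} (ω : Seed n φ ε) (j : Fin (reps n φ ε)) : ℕ :=
  min ((ω j).1 + 1) (a n φ)

/-- The Balls-into-Bins Broadcast algorithm. In iteration `j`, started in round `s`, a station
skips `(min {x, a} - 1) * k` rounds, and performs Balls-into-Bins with `k` slots in the following
`k` rounds, in which it transmits once. -/
noncomputable def protocol (n : ℕ) (φ ε : ℝ) : BroadcastProtocol (Seed n φ ε) where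
  State := State (reps n φ ε)
  start := ready (reps n φ ε) 0
  transmits ω t st :=
    match enter n φ ε t st with
    | .running j s => t = s + (bucket ω j - 1) * k n φ + (ω j).2
    | _ => False
  next ω t _ st :=
    match enter n φ ε t st with
    | .running j s =>
        if t + 1 = s + bucket ω j * k n φ then ready (reps n φ ε) (j + 1) else .running j s
    | st' => st'
  halted st := st = .halted

end GGB

/-! ### The execution, phase by phase -/

/-! Informed stations start their iterations together, in rounds divisible by `tph`, so at phase
boundaries the network is described by the number of iterations each station has performed (`none`:
no message). `phaseStep` updates these counts. Each phase reads choices that no earlier phase has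
read, so the counts form a Markov chain (`law_iterate_succ`). A count grows by one per phase, which
gives `energy_le`.

Write N = n^(1/φ). The heart is `law_phaseStep_eq_none_le`: an uninformed station with m ≥ 1 active
neighbours misses the message in a phase with probability at most 1/N. If 4m ≤ k, the bucket of any
one neighbour is sparse enough. Otherwise the expected number of neighbours reaching a bucket
shrinks by the factor φ/N from each bucket to the next, so some bucket has expected size between 2
ln N and 4N ln N, and is probably neither empty nor too full. Inside a bucket, j balls fall into k
bins. Allocations without a singleton bin have exponential generating function (e^x - x)^k, whose
value at a well-chosen x > 0 bounds their number (`card_noSingle_mul_pow_le`).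

For the whole graph, let s = N^(-1/2). Two potentials do not grow in expectation over a phase: s^2
to the number of attempts left to the oldest neighbour of v, and β^d s^p, with d the distance of v
to the informed stations and p the number of phases left. Their sum over v bounds the probability
that somebody remains uninformed (`law_exists_uninformed_le`). With β = s^(-5) and p = 5D + 2R, each
is initially at most N^(-R) ≤ ε/(2n), so the sum is at most ε. Another R phases let everybody
terminate. -/

namespace GGB

variable {V : Type*} {n : ℕ} {φ ε : ℝ}

/-- The round, counted from the beginning of the phase, in which a station with seed `ω`
transmits during its iteration `j`. -/
noncomputable def slot (ω : Seed n φ ε) (j : Fin (reps n φ ε)) : ℕ :=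
  (bucket ω j - 1) * k n φ + (ω j).2

/-- If `σ v` is the number of iterations that station `v` has performed before a phase (`none` if
it does not have the message), then `Sends σ ω v r` tells whether it transmits in round `r` of the
phase. -/
def Sends (σ : V → Option ℕ) (ω : V → Seed n φ ε) (v : V) (r : ℕ) : Prop :=
  ∃ j : Fin (reps n φ ε), σ v = some j.val ∧ r = slot (ω v) j

open Classical in
/-- The effect of a phase on the numbers of performed iterations. -/
noncomputable def phaseStep (G : SimpleGraph V) (ω : V → Seed n φ ε) (σ : V → Option ℕ) :
    V → Option ℕ := fun v =>
  match σ v with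
  | some i => some (i + 1)
  | none => if ∃ r < tph n φ, ∃! u, G.Adj v u ∧ Sends σ ω u r then some 0 else none

open Classical in
/-- Initially only the originator has the message. -/
noncomputable def phaseStart (o : V) : V → Option ℕ := fun v => if v = o then some 0 else none

/-- The state in round `r` of a phase that began in round `s`, of a station that had performed
`i` iterations before the phase. -/
noncomputable def phaseState (ω : Seed n φ ε) (s r i : ℕ) : State (reps n φ ε) :=
  if h : i < reps n φ ε then
    if r = 0 then .waiting ⟨i, h⟩
    else if r < bucket ω ⟨i, h⟩ * k n φ then .running ⟨i, h⟩ s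
    else ready (reps n φ ε) (i + 1)
  else .halted

open Classical in
/-- The configuration in round `r` of a phase that began in round `s`. -/
noncomputable def phaseConfig (G : SimpleGraph V) (ω : V → Seed n φ ε) (σ : V → Option ℕ)
    (s r : ℕ) : (protocol n φ ε).Config V := fun v =>
  match σ v with
  | some i => some (phaseState (ω v) s r i)
  | none => if ∃ r' < r, ∃! u, G.Adj v u ∧ Sends σ ω u r' then some (ready _ 0) else none

lemma k_pos (n : ℕ) (φ : ℝ) : 0 < k n φ := by unfold k; omega

lemma bucket_le (ω : Seed n φ ε) (j) : bucket ω j ≤ a n φ := min_le_right _ _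

lemma bucket_pos (ha : 0 < a n φ) (ω : Seed n φ ε) (j) : 0 < bucket ω j :=
  lt_min (Nat.succ_pos _) ha

lemma bucket_mul_k_le (ω : Seed n φ ε) (j) : bucket ω j * k n φ ≤ tph n φ :=
  Nat.mul_le_mul_right _ (bucket_le ω j)

lemma slot_lt_bucket (ha : 0 < a n φ) (ω : Seed n φ ε) (j) :
    slot ω j < bucket ω j * k n φ := by
  have h1 := bucket_pos ha ω j
  have h2 : ((ω j).2 : ℕ) < k n φ := (ω j).2.2
  obtain ⟨b, hb⟩ := Nat.exists_eq_add_of_lt h1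
  rw [slot, hb]
  simp only [zero_add, Nat.add_sub_cancel]
  rw [add_mul, one_mul]
  omega

lemma add_mod_tph {p r : ℕ} (hr : r < tph n φ) : (p * tph n φ + r) % tph n φ = r := by
  rw [mul_comm, Nat.mul_add_mod, Nat.mod_eq_of_lt hr]

lemma enter_ready {t j : ℕ} (h : t % tph n φ ≠ 0) :
    enter n φ ε t (ready (reps n φ ε) j) = ready (reps n φ ε) j := by
  unfold ready
  split_ifs <;> simp [enter, h]

/-- After the waiting, in round `r < tph` of a phase. -/
lemma enter_phaseState (ha : 0 < a n φ) (ω : Seed n φ ε) (p : ℕ) {r i : ℕ} (hr : r < tph n φ) :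
    enter n φ ε (p * tph n φ + r) (phaseState ω (p * tph n φ) r i) =
      if h : i < reps n φ ε then
        if r < bucket ω ⟨i, h⟩ * k n φ then .running ⟨i, h⟩ (p * tph n φ)
        else ready (reps n φ ε) (i + 1)
      else .halted := by
  unfold phaseState
  by_cases h : i < reps n φ ε
  · simp only [h, dif_pos]
    rcases Nat.eq_zero_or_pos r with rfl | hr0
    · have : 0 < bucket ω ⟨i, h⟩ * k n φ := Nat.mul_pos (bucket_pos ha _ _) (k_pos _ _)
      simp [enter, this]
    · have hmod : (p * tph n φ + r) % tph n φ ≠ 0 := by rw [add_mod_tph hr]; omega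
      rw [if_neg hr0.ne']
      split_ifs with h1
      · simp [enter]
      · rw [enter_ready hmod]
  · simp [h, enter]

lemma protocol_transmits_iff (ω : Seed n φ ε) (t : ℕ) (st : State (reps n φ ε)) :
    (protocol n φ ε).transmits ω t st ↔
      ∃ j s, enter n φ ε t st = .running j s ∧ t = s + slot ω j := by
  simp only [protocol, slot]
  cases enter n φ ε t st <;> simp [add_assoc]

/-- A station informed during the phase is in state `ready _ 0` and stays silent, because no later
round of the phase is divisible by `tph`. An active station is still running when its slot comes. -/
lemma transmits_phaseConfig (ha : 0 < a n φ) (G : SimpleGraph V) (ω : V → Seed n φ ε)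
    (σ : V → Option ℕ) (p : ℕ) {r : ℕ} (hr : r < tph n φ) (v : V) :
    (protocol n φ ε).Transmits ω (p * tph n φ + r) (phaseConfig G ω σ (p * tph n φ) r) v ↔
      Sends σ ω v r := by
  unfold BroadcastProtocol.Transmits Sends phaseConfig
  cases hσ : σ v with
  | some i =>
    constructor
    · rintro ⟨s, hs, H⟩
      obtain rfl := Option.some.inj hs
      obtain ⟨j, s, h1, h2⟩ := (protocol_transmits_iff _ _ _).1 H
      rw [enter_phaseState ha (ω v) p hr] at h1
      split_ifs at h1 with h3 h4
      · obtain ⟨rfl, rfl⟩ := State.running.inj h1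
        exact ⟨⟨i, h3⟩, rfl, by omega⟩
      · unfold ready at h1
        split_ifs at h1
    · rintro ⟨j, hj, hrj⟩
      obtain rfl : i = j := Option.some.inj hj
      refine ⟨_, rfl, (protocol_transmits_iff _ _ _).2 ⟨j, p * tph n φ, ?_, by omega⟩⟩
      rw [enter_phaseState ha (ω v) p hr, dif_pos j.2,
        if_pos (hrj ▸ slot_lt_bucket ha (ω v) j)]
  | none =>
    simp only [reduceCtorEq, false_and, exists_false, iff_false, not_exists, not_and]
    intro s hs H
    split_ifs at hs with h1
    obtain rfl := Option.some.inj hs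
    obtain ⟨r', hr', -⟩ := h1
    obtain ⟨j, s, h1, h2⟩ := (protocol_transmits_iff _ _ _).1 H
    rw [enter_ready (by rw [add_mod_tph hr]; omega)] at h1
    unfold ready at h1
    split_ifs at h1

lemma step_phaseConfig (ha : 0 < a n φ) (G : SimpleGraph V) (ω : V → Seed n φ ε)
    (σ : V → Option ℕ) (p : ℕ) {r : ℕ} (hr : r < tph n φ) :
    (protocol n φ ε).step G ω (p * tph n φ + r) (phaseConfig G ω σ (p * tph n φ) r) =
      phaseConfig G ω σ (p * tph n φ) (r + 1) := by
  have hT := transmits_phaseConfig ha G ω σ p hr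
  have hrec : ∀ v, (∃! u, G.Adj v u ∧
      (protocol n φ ε).Transmits ω (p * tph n φ + r) (phaseConfig G ω σ (p * tph n φ) r) u) ↔
      ∃! u, G.Adj v u ∧ Sends σ ω u r := fun v => by simp only [hT]
  funext v
  unfold BroadcastProtocol.step
  have hR : (protocol n φ ε).Receives G ω (p * tph n φ + r)
      (phaseConfig G ω σ (p * tph n φ) r) v ↔
      ¬ Sends σ ω v r ∧ ∃! u, G.Adj v u ∧ Sends σ ω u r := by
    unfold BroadcastProtocol.Receives; rw [hT, hrec]
  cases hσ : σ v with
  | some i =>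
    simp only [phaseConfig, hσ]
    congr 1
    simp only [protocol, enter_phaseState ha (ω v) p hr]
    unfold phaseState
    by_cases h : i < reps n φ ε
    · simp only [h, dif_pos, Nat.succ_ne_zero, if_false]
      by_cases h1 : r < bucket (ω v) ⟨i, h⟩ * k n φ
      · simp only [h1, if_true]
        by_cases h2 : r + 1 < bucket (ω v) ⟨i, h⟩ * k n φ
        · rw [if_pos h2, if_neg (by omega)]
        · rw [if_neg h2, if_pos (by omega)]
      · rw [if_neg h1, if_neg (by omega)]
        unfold ready
        split_ifs <;> rfl
    · simp [h]
  | none =>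
    have hns : ¬ Sends σ ω v r := by rintro ⟨j, hj, -⟩; rw [hσ] at hj; cases hj
    by_cases h1 : ∃ r' < r, ∃! u, G.Adj v u ∧ Sends σ ω u r'
    · have h2 : ∃ r' < r + 1, ∃! u, G.Adj v u ∧ Sends σ ω u r' := by
        obtain ⟨r', h, h'⟩ := h1; exact ⟨r', by omega, h'⟩
      simp only [phaseConfig, hσ]
      rw [if_pos h1, if_pos h2]
      simp only
      obtain ⟨r', hr', -⟩ := h1
      simp only [protocol]
      rw [enter_ready (by rw [add_mod_tph hr]; omega)]
      unfold ready
      split_ifs <;> rfl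
    · have hc : phaseConfig G ω σ (p * tph n φ) r v = none := by
        simp only [phaseConfig, hσ]; rw [if_neg h1]
      have h3 : (∃ r' < r + 1, ∃! u, G.Adj v u ∧ Sends σ ω u r') ↔
          ∃! u, G.Adj v u ∧ Sends σ ω u r := by
        constructor
        · rintro ⟨r', h, h'⟩
          rcases Nat.lt_succ_iff_lt_or_eq.1 h with h | rfl
          · exact absurd ⟨r', h, h'⟩ h1
          · exact h'
        · exact fun h => ⟨r, by omega, h⟩
      have hE : phaseConfig G ω σ (p * tph n φ) (r + 1) v =
          open Classical in
          if ∃! u, G.Adj v u ∧ Sends σ ω u r then some (ready _ 0) else none := by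
        simp only [phaseConfig, hσ]
        by_cases h4 : ∃! u, G.Adj v u ∧ Sends σ ω u r
        · rw [if_pos (h3.2 h4), if_pos h4]; rfl
        · rw [if_neg (mt h3.1 h4), if_neg h4]; rfl
      have hR' := hR.trans (and_iff_right hns)
      rw [hE, hc]
      by_cases h4 : ∃! u, G.Adj v u ∧ Sends σ ω u r
      · rw [if_pos h4]; exact if_pos (hR'.2 h4)
      · rw [if_neg h4]; exact if_neg (mt hR'.1 h4)

lemma phaseConfig_zero (G : SimpleGraph V) (ω : V → Seed n φ ε) (σ : V → Option ℕ) (s : ℕ) :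
    phaseConfig G ω σ s 0 = fun v => (σ v).map (ready (reps n φ ε)) := by
  funext v
  unfold phaseConfig phaseState ready
  cases σ v with
  | some i => rfl
  | none => simp only [Nat.not_lt_zero, false_and, exists_false, if_false]; rfl

/-- Iterations end inside their phase since `bucket ≤ a`. The round `s'` is arbitrary: in round 0 of
a phase no state records the starting round yet. -/
lemma phaseConfig_tph (ha : 0 < a n φ) (G : SimpleGraph V) (ω : V → Seed n φ ε)
    (σ : V → Option ℕ) (s s' : ℕ) :
    phaseConfig G ω σ s (tph n φ) = phaseConfig G ω (phaseStep G ω σ) s' 0 := by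
  have ht : 0 < tph n φ := Nat.mul_pos ha (k_pos _ _)
  rw [phaseConfig_zero]
  funext v
  unfold phaseConfig phaseStep phaseState
  cases σ v with
  | some i =>
    simp only [Option.map_some, ht.ne', if_false]
    congr 1
    split_ifs with h h1
    · exact absurd h1 (not_lt.2 (bucket_mul_k_le _ _))
    · rfl
    · unfold ready; rw [dif_neg (by omega)]
  | none =>
    simp only
    split_ifs <;> rfl

/-- The configuration in round `r` of phase `p`. -/
lemma config_eq_phaseConfig (ha : 0 < a n φ) (G : SimpleGraph V) (o : V) (ω : V → Seed n φ ε)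
    (p : ℕ) {r : ℕ} (hr : r ≤ tph n φ) :
    (protocol n φ ε).config G o ω (p * tph n φ + r) =
      phaseConfig G ω ((phaseStep G ω)^[p] (phaseStart o)) (p * tph n φ) r := by
  have hphase : ∀ (p : ℕ), (protocol n φ ε).config G o ω (p * tph n φ) =
      phaseConfig G ω ((phaseStep G ω)^[p] (phaseStart o)) (p * tph n φ) 0 →
      ∀ r ≤ tph n φ, (protocol n φ ε).config G o ω (p * tph n φ + r) =
        phaseConfig G ω ((phaseStep G ω)^[p] (phaseStart o)) (p * tph n φ) r := by
    intro p hp r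
    induction r with
    | zero => intro _; exact hp
    | succ r ih =>
      intro hr
      rw [← step_phaseConfig ha G ω _ p hr, ← ih (by omega)]
      rfl
  suffices h : (protocol n φ ε).config G o ω (p * tph n φ) =
      phaseConfig G ω ((phaseStep G ω)^[p] (phaseStart o)) (p * tph n φ) 0 from
    hphase p h r hr
  induction p with
  | zero =>
    rw [phaseConfig_zero]
    funext v
    simp only [Nat.zero_mul, Function.iterate_zero, id, phaseStart]
    unfold BroadcastProtocol.config
    split_ifs <;> rfl
  | succ p ih =>
    rw [add_mul, one_mul, hphase p ih _ le_rfl, phaseConfig_tph ha G ω _ _ (p * tph n φ + tph n φ),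
      Function.iterate_succ_apply']

lemma iterate_phaseStep_of_some (G : SimpleGraph V) (ω : V → Seed n φ ε) {σ : V → Option ℕ}
    {v : V} {i : ℕ} (h : σ v = some i) (p : ℕ) : (phaseStep G ω)^[p] σ v = some (i + p) := by
  induction p with
  | zero => simpa using h
  | succ p ih => rw [Function.iterate_succ_apply', phaseStep, ih]; rfl

lemma config_phase (ha : 0 < a n φ) (G : SimpleGraph V) (o : V) (ω : V → Seed n φ ε) (p : ℕ) :
    (protocol n φ ε).config G o ω (p * tph n φ) =
      fun v => ((phaseStep G ω)^[p] (phaseStart o) v).map (ready (reps n φ ε)) := by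
  have := config_eq_phaseConfig ha G o ω p (Nat.zero_le _)
  rwa [add_zero, phaseConfig_zero] at this

/-- If all stations have the message after `p` phases, then `reps` phases later all have
terminated. -/
lemma completedBy (ha : 0 < a n φ) (G : SimpleGraph V) (o : V) (ω : V → Seed n φ ε) (p : ℕ)
    (h : ∀ v, (phaseStep G ω)^[p] (phaseStart o) v ≠ none) :
    (protocol n φ ε).CompletedBy G o ω ((p + reps n φ ε) * tph n φ) := by
  intro v
  obtain ⟨i, hi⟩ := Option.ne_none_iff_exists'.1 (h v)
  refine ⟨.halted, ?_, rfl⟩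
  have h1 : (phaseStep G ω)^[p + reps n φ ε] (phaseStart o) v = some (i + reps n φ ε) := by
    rw [add_comm p, Function.iterate_add_apply, iterate_phaseStep_of_some G ω hi]
  rw [config_phase ha]
  simp only [h1, Option.map_some, ready]
  rw [dif_neg (by omega)]
  rfl

/-- Sending each transmission to its iteration is injective: the iteration determines the phase,
since counts grow by one per phase, and its slot determines the round inside the phase. -/
lemma energy_le (ha : 0 < a n φ) (G : SimpleGraph V) (o : V) (ω : V → Seed n φ ε) (v : V) :
    (protocol n φ ε).energy G o ω v ≤ (reps n φ ε : ℕ∞) := by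
  have ht : 0 < tph n φ := Nat.mul_pos ha (k_pos _ _)
  have key : ∀ t, (protocol n φ ε).Transmits ω t ((protocol n φ ε).config G o ω t) v →
      ∃ j : Fin (reps n φ ε), (phaseStep G ω)^[t / tph n φ] (phaseStart o) v = some j.val ∧
        t % tph n φ = slot (ω v) j := by
    intro t h
    have hr := Nat.mod_lt t ht
    have h2 := transmits_phaseConfig ha G ω ((phaseStep G ω)^[t / tph n φ] (phaseStart o))
      (t / tph n φ) hr v
    rw [← config_eq_phaseConfig ha G o ω _ hr.le, mul_comm, Nat.div_add_mod] at h2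
    exact h2.1 h
  rcases (reps n φ ε).eq_zero_or_pos with h0 | h0
  · have : IsEmpty (Fin (reps n φ ε)) := by rw [h0]; infer_instance
    unfold BroadcastProtocol.energy
    rw [Set.encard_eq_zero.2]
    · exact zero_le
    · exact Set.eq_empty_of_forall_notMem fun t ht => isEmptyElim (key t ht).choose
  have : Nonempty (Fin (reps n φ ε)) := ⟨⟨0, h0⟩⟩
  choose! f hf using key
  unfold BroadcastProtocol.energy
  have hinj : Set.InjOn f
      {t | (protocol n φ ε).Transmits ω t ((protocol n φ ε).config G o ω t) v} := by
    have main : ∀ t t', (protocol n φ ε).Transmits ω t ((protocol n φ ε).config G o ω t) v →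
        (protocol n φ ε).Transmits ω t' ((protocol n φ ε).config G o ω t') v → f t = f t' →
        t / tph n φ ≤ t' / tph n φ → t = t' := by
      intro t t' h h' hft hle
      obtain ⟨h1, h2⟩ := hf t h
      obtain ⟨h1', h2'⟩ := hf t' h'
      obtain ⟨d, hd⟩ := Nat.exists_eq_add_of_le hle
      rw [hd, add_comm, Function.iterate_add_apply, iterate_phaseStep_of_some G ω h1, hft,
        Option.some.injEq] at h1'
      have hd0 : d = 0 := by omega
      rw [← Nat.div_add_mod t (tph n φ), ← Nat.div_add_mod t' (tph n φ), h2, h2', hd, hd0, hft,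
        add_zero]
    intro t h t' h' hft
    rcases le_total (t / tph n φ) (t' / tph n φ) with hle | hle
    · exact main t t' h h' hft hle
    · exact (main t' t h' h hft.symm hle).symm
  calc _ ≤ (Set.univ : Set (Fin (reps n φ ε))).encard :=
        Set.encard_le_encard_of_injOn (fun _ _ => Set.mem_univ _) hinj
    _ = _ := by simp

end GGB

/-! ### Fresh randomness in every phase -/

/-- Combining two independent samples of a product measure coordinate by coordinate. -/
lemma MeasureTheory.measurePreserving_pi_prod_pi {ι α : Type*} [Fintype ι] [MeasurableSpace α]
    (μ : ι → Measure α) [∀ i, IsProbabilityMeasure (μ i)] {f : ι → α × α → α}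
    (hf : ∀ i, MeasurePreserving (f i) ((μ i).prod (μ i)) (μ i)) :
    MeasurePreserving (fun (x : (ι → α) × (ι → α)) i => f i (x.1 i, x.2 i))
      ((Measure.pi μ).prod (Measure.pi μ)) (Measure.pi μ) :=
  (measurePreserving_pi _ _ hf).comp
    (measurePreserving_arrowProdEquivProdArrow α α ι μ μ).symm

namespace GGB

variable {V : Type*} {n : ℕ} {φ ε : ℝ}

instance : NeZero (k n φ) := ⟨(k_pos n φ).ne'⟩

instance : IsProbabilityMeasure (uniformOn (Set.univ : Set (Fin (k n φ)))) :=
  isProbabilityMeasure_uniformOn Set.finite_univ Set.univ_nonempty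

instance : IsProbabilityMeasure (seedLaw n φ ε) := by unfold seedLaw; infer_instance

instance [Fintype V] : IsProbabilityMeasure (law V n φ ε) := by unfold law; infer_instance

instance : Countable (Seed n φ ε) := inferInstanceAs (Countable (Fin _ → ℕ × Fin _))

instance : DiscreteMeasurableSpace (Seed n φ ε) :=
  inferInstanceAs (DiscreteMeasurableSpace (Fin _ → ℕ × Fin _))

/-- Every set of random choices is measurable, since there are countably many choices. -/
lemma measurableSet_seeds [Fintype V] (S : Set (V → Seed n φ ε)) : MeasurableSet S :=
  .of_discrete

lemma measurable_seeds [Fintype V] {β : Type*} [MeasurableSpace β] (f : (V → Seed n φ ε) → β) :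
    Measurable f := .of_discrete

open Classical in
/-- Taking the random choices in `B` from `x.1` and the others from `x.2`. -/
noncomputable def merge (B : V → Fin (reps n φ ε) → Prop)
    (x : (V → Seed n φ ε) × (V → Seed n φ ε)) : V → Seed n φ ε :=
  fun v j => if B v j then x.1 v j else x.2 v j

lemma measurePreserving_merge [Fintype V] (B : V → Fin (reps n φ ε) → Prop) :
    MeasurePreserving (merge B) ((law V n φ ε).prod (law V n φ ε)) (law V n φ ε) := by
  classical
  refine measurePreserving_pi_prod_pi (fun _ : V => seedLaw n φ ε)
    (f := fun v x j => if B v j then x.1 j else x.2 j) fun v => ?_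
  refine measurePreserving_pi_prod_pi _ (f := fun j x => if B v j then x.1 else x.2) fun j => ?_
  split_ifs
  · exact measurePreserving_fst
  · exact measurePreserving_snd

lemma phaseStep_congr (G : SimpleGraph V) {σ : V → Option ℕ} {ω ω' : V → Seed n φ ε}
    (h : ∀ u (j : Fin (reps n φ ε)), σ u = some j.val → ω u j = ω' u j) :
    phaseStep G ω σ = phaseStep G ω' σ := by
  have hS : Sends σ ω = Sends σ ω' := by
    funext u r
    apply propext
    unfold Sends slot bucket
    refine exists_congr fun j => and_congr_right fun hj => ?_
    rw [h u j hj]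
  funext v
  unfold phaseStep
  rw [hS]

/-- Only choices with index at least the current count can still be read; for an uninformed station
these are all of them. -/
lemma iterate_phaseStep_congr (G : SimpleGraph V) {ω ω' : V → Seed n φ ε} (p : ℕ) :
    ∀ {σ : V → Option ℕ}, (∀ u (j : Fin (reps n φ ε)),
      (∀ i, σ u = some i → i ≤ j.val) → ω u j = ω' u j) →
      (phaseStep G ω)^[p] σ = (phaseStep G ω')^[p] σ := by
  induction p with
  | zero => intros; rfl
  | succ p ih =>
    intro σ h
    rw [Function.iterate_succ_apply, Function.iterate_succ_apply,
      ← phaseStep_congr G (ω := ω) (ω' := ω') (σ := σ)]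
    · refine ih fun u j hj => h u j fun i hi => ?_
      have := hj (i + 1) (by simp [phaseStep, hi])
      omega
    · intro u j hj
      exact h u j fun i hi => by rw [hj] at hi; exact (Option.some.inj hi).ge

/-- After a phase, the execution goes on as if all random choices were drawn afresh. -/
lemma law_iterate_succ [Fintype V] (G : SimpleGraph V) (σ : V → Option ℕ) (p : ℕ)
    (Q : (V → Option ℕ) → Prop) :
    law V n φ ε {ω | Q ((phaseStep G ω)^[p + 1] σ)} =
      ∫⁻ ω, law V n φ ε {ω' | Q ((phaseStep G ω')^[p] (phaseStep G ω σ))} ∂law V n φ ε := by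
  -- Split the seed into two independent copies: the choices read in the present phase come from the
  -- first, all others from the second.
  rw [← (measurePreserving_merge fun v j => σ v = some j.val).measure_preimage
    (measurableSet_seeds _).nullMeasurableSet, Measure.prod_apply
    ((measurePreserving_merge _).measurable (measurableSet_seeds _))]
  refine lintegral_congr fun ω => congrArg _ (Set.ext fun ω' => ?_)
  simp only [Set.mem_preimage, Set.mem_ofPred_eq]
  rw [Function.iterate_succ_apply, phaseStep_congr G (ω' := ω)]
  · rw [iterate_phaseStep_congr G (ω' := ω')]
    intro u j hj
    unfold merge
    rw [if_neg]
    intro h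
    -- A choice used in this phase has index below the new count, so no later phase reads it.
    have := hj (j.val + 1) (by simp [phaseStep, h])
    omega
  · intro u j hj
    exact if_pos hj

/-! ### The number of phases -/

section Potential

open scoped ENNReal

variable (G : SimpleGraph V) (R : ℕ) (s β : ℝ≥0∞)

open Classical in
/-- The largest number of iterations that a neighbour of `w` has performed. -/
noncomputable def oldest [Fintype V] (σ : V → Option ℕ) (w : V) : ℕ :=
  (Finset.univ.filter (G.Adj w)).sup fun u => (σ u).getD 0

open Classical in
/-- An upper bound for the probability that `w` is missed by all its neighbours. -/
noncomputable def missPotential [Fintype V] (σ : V → Option ℕ) (w : V) : ℝ≥0∞ :=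
  if σ w = none then (s ^ 2) ^ (R - oldest G σ w) else 0

/-- The distance of `v` to the nearest station that has the message. -/
noncomputable def distInformed (σ : V → Option ℕ) (v : V) : ℕ :=
  sInf {d | ∃ u, σ u ≠ none ∧ G.dist u v = d}

open Classical in
/-- An upper bound for the probability that the message does not reach `v` within `p` phases,
although no station is missed by its neighbours. -/
noncomputable def slowPotential (p : ℕ) (σ : V → Option ℕ) (v : V) : ℝ≥0∞ :=
  if σ v = none then β ^ distInformed G σ v * s ^ p else 0

variable {G R s β}

lemma le_oldest [Fintype V] {σ : V → Option ℕ} {w u : V} {i : ℕ} (h : G.Adj w u) (hu : σ u = some i) :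
    i ≤ oldest G σ w := by
  classical
  calc i = (σ u).getD 0 := by rw [hu]; rfl
    _ ≤ _ := Finset.le_sup (f := fun u => (σ u).getD 0)
      (Finset.mem_filter.2 ⟨Finset.mem_univ u, h⟩)

lemma oldest_phaseStep_le [Fintype V] (σ : V → Option ℕ) (ω : V → Seed n φ ε) (w : V) :
    oldest G (phaseStep G ω σ) w ≤ oldest G σ w + 1 := by
  classical
  refine Finset.sup_le fun u hu => ?_
  unfold phaseStep
  cases h : σ u with
  | some i =>
    have := le_oldest (Finset.mem_filter.1 hu).2 h
    simpa using this
  | none => simp only; split_ifs <;> simp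

lemma oldest_phaseStep_of_uninformed [Fintype V] {σ : V → Option ℕ} (ω : V → Seed n φ ε) {w : V}
    (h : ∀ u, G.Adj w u → σ u = none) : oldest G (phaseStep G ω σ) w = 0 := by
  classical
  refine Nat.eq_zero_of_le_zero (Finset.sup_le fun u hu => ?_)
  unfold phaseStep
  rw [h u (Finset.mem_filter.1 hu).2]
  simp only
  split_ifs <;> simp

lemma phaseStep_ne_none {σ : V → Option ℕ} (ω : V → Seed n φ ε) {v : V} (h : σ v ≠ none) :
    phaseStep G ω σ v ≠ none := by
  obtain ⟨i, hi⟩ := Option.ne_none_iff_exists'.1 h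
  simp [phaseStep, hi]

lemma distInformed_le {σ : V → Option ℕ} {u : V} (h : σ u ≠ none) (v : V) :
    distInformed G σ v ≤ G.dist u v := Nat.sInf_le ⟨u, h, rfl⟩

lemma exists_dist_eq_distInformed {σ : V → Option ℕ} (h : ∃ u, σ u ≠ none) (v : V) :
    ∃ u, σ u ≠ none ∧ G.dist u v = distInformed G σ v := by
  obtain ⟨u, hu⟩ := h
  exact Nat.sInf_mem (s := {d | ∃ u, σ u ≠ none ∧ G.dist u v = d}) ⟨_, u, hu, rfl⟩

/-- With an informed neighbour, the exponent drops by at most one, and only if `w` is missed again,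
which has probability at most `s ^ 2`. Without one, neighbours informed in this phase have count 0,
so the exponent is the full `reps`. -/
lemma lintegral_missPotential_le [Fintype V] (hs : s ≤ 1)
    (hfail : ∀ (σ : V → Option ℕ) (w : V), σ w = none →
      (∃ u, G.Adj w u ∧ ∃ j : Fin (reps n φ ε), σ u = some j.val) →
      law V n φ ε {ω | phaseStep G ω σ w = none} ≤ s ^ 2)
    {σ : V → Option ℕ} {w : V} (hw : σ w = none → oldest G σ w < reps n φ ε) :
    ∫⁻ ω, missPotential G (reps n φ ε) s (phaseStep G ω σ) w ∂law V n φ ε ≤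
      missPotential G (reps n φ ε) s σ w := by
  have hs2 : s ^ 2 ≤ 1 := pow_le_one₀ zero_le hs
  cases h : σ w with
  | some i =>
    have : ∀ ω : V → Seed n φ ε, missPotential G (reps n φ ε) s (phaseStep G ω σ) w = 0 :=
      fun ω => if_neg (phaseStep_ne_none ω (by simp [h]))
    simp [this]
  | none =>
    have hlt := hw h
    conv_rhs => unfold missPotential
    rw [if_pos h]
    by_cases hu : ∃ u, G.Adj w u ∧ σ u ≠ none
    · obtain ⟨u, hadj, hu⟩ := hu
      obtain ⟨i, hi⟩ := Option.ne_none_iff_exists'.1 hu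
      have hf := hfail σ w h ⟨u, hadj, ⟨i, (le_oldest hadj hi).trans_lt hlt⟩, hi⟩
      obtain ⟨d, hd⟩ := Nat.exists_eq_add_of_lt hlt
      have hd' : reps n φ ε - oldest G σ w = d + 1 := by omega
      calc ∫⁻ ω, missPotential G (reps n φ ε) s (phaseStep G ω σ) w ∂law V n φ ε
          ≤ ∫⁻ ω, ({ω | phaseStep G ω σ w = none} : Set (V → Seed n φ ε)).indicator
              (fun _ => (s ^ 2) ^ d) ω ∂law V n φ ε := by
            refine lintegral_mono fun ω => ?_
            unfold missPotential
            by_cases hω : phaseStep G ω σ w = none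
            · rw [if_pos hω, Set.indicator_of_mem (s := {ω | phaseStep G ω σ w = none}) hω]
              refine pow_le_pow_of_le_one zero_le hs2 ?_
              have := oldest_phaseStep_le (G := G) σ ω w
              omega
            · rw [if_neg hω]; exact zero_le
        _ = (s ^ 2) ^ d * law V n φ ε {ω | phaseStep G ω σ w = none} := by
            rw [lintegral_indicator_const (measurableSet_seeds _)]
        _ ≤ (s ^ 2) ^ d * s ^ 2 := by gcongr
        _ = _ := by rw [hd', ← pow_succ]
    · have hu' : ∀ u, G.Adj w u → σ u = none := fun u hadj => by
        by_contra hne; exact hu ⟨u, hadj, hne⟩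
      calc ∫⁻ ω, missPotential G (reps n φ ε) s (phaseStep G ω σ) w ∂law V n φ ε
          ≤ ∫⁻ _, (s ^ 2) ^ reps n φ ε ∂law V n φ ε := by
            refine lintegral_mono fun ω => ?_
            unfold missPotential
            split_ifs
            · rw [oldest_phaseStep_of_uninformed ω hu', Nat.sub_zero]
            · exact zero_le
        _ = (s ^ 2) ^ reps n φ ε := by simp
        _ ≤ _ := pow_le_pow_of_le_one zero_le hs2 (Nat.sub_le _ _)

/-- Let `w` follow the nearest informed station on a geodesic to `v`. If `w` is informed, the
distance drops to `r`; otherwise it is at most `r + 1`. The expectation is thus at most `β ^ r * (1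
+ s ^ 2 * β)` times `s ^ p`, and `hβ` pays for it with one factor `s`. By `hlive`, every informed
neighbour of an uninformed station is still active. -/
lemma lintegral_slowPotential_le [Fintype V] (hG : G.Connected) (hβ1 : 1 ≤ β)
    (hβ : 1 + s ^ 2 * β ≤ β * s)
    (hfail : ∀ (σ : V → Option ℕ) (w : V), σ w = none →
      (∃ u, G.Adj w u ∧ ∃ j : Fin (reps n φ ε), σ u = some j.val) →
      law V n φ ε {ω | phaseStep G ω σ w = none} ≤ s ^ 2)
    {σ : V → Option ℕ} (hσ : ∃ u, σ u ≠ none)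
    (hlive : ∀ w, σ w = none → oldest G σ w < reps n φ ε) (p : ℕ) (v : V) :
    ∫⁻ ω, slowPotential G s β p (phaseStep G ω σ) v ∂law V n φ ε ≤
      slowPotential G s β (p + 1) σ v := by
  cases h : σ v with
  | some i =>
    have : ∀ ω : V → Seed n φ ε, slowPotential G s β p (phaseStep G ω σ) v = 0 :=
      fun ω => if_neg (phaseStep_ne_none ω (by simp [h]))
    simp [this]
  | none =>
    obtain ⟨u, hu, hd⟩ := exists_dist_eq_distInformed (G := G) hσ v
    have huv : u ≠ v := fun e => hu (e ▸ h)
    obtain ⟨r, hr⟩ : ∃ r, G.dist u v = r + 1 :=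
      Nat.exists_eq_succ_of_ne_zero (hG.pos_dist_of_ne huv).ne'
    obtain ⟨w, hadj, hwr⟩ : ∃ w, G.Adj u w ∧ G.dist w v = r := by
      obtain ⟨q, hq⟩ := (hG u v).exists_walk_length_eq_dist
      cases q with
      | nil => exact absurd rfl huv
      | cons hadj q =>
        rw [SimpleGraph.Walk.length_cons] at hq
        refine ⟨_, hadj, le_antisymm ?_ ?_⟩
        · exact (SimpleGraph.dist_le q).trans (by omega)
        · have := hG.dist_triangle (u := u) (v := _) (w := v) |>.trans
            (Nat.add_le_add_right (SimpleGraph.dist_eq_one_iff_adj.2 hadj).le _)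
          omega
    have hw : σ w = none := by
      by_contra hne
      have := distInformed_le (G := G) hne v
      omega
    obtain ⟨i, hi⟩ := Option.ne_none_iff_exists'.1 hu
    have hf := hfail σ w hw ⟨u, hadj.symm, ⟨i, (le_oldest hadj.symm hi).trans_lt (hlive w hw)⟩, hi⟩
    conv_rhs => unfold slowPotential
    rw [if_pos h, ← hd, hr]
    calc ∫⁻ ω, slowPotential G s β p (phaseStep G ω σ) v ∂law V n φ ε
        ≤ ∫⁻ ω, β ^ r * s ^ p + ({ω | phaseStep G ω σ w = none} : Set (V → Seed n φ ε)).indicator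
            (fun _ => β ^ (r + 1) * s ^ p) ω ∂law V n φ ε := by
          refine lintegral_mono fun ω => ?_
          unfold slowPotential
          split_ifs
          · by_cases hω : phaseStep G ω σ w = none
            · rw [Set.indicator_of_mem (s := {ω | phaseStep G ω σ w = none}) hω]
              refine le_add_left (mul_le_mul_left (pow_le_pow_right₀ hβ1 ?_) _)
              exact (distInformed_le (phaseStep_ne_none ω hu) v).trans hr.le
            · refine le_add_right (mul_le_mul_left (pow_le_pow_right₀ hβ1 ?_) _)
              exact (distInformed_le hω v).trans hwr.le
          · exact zero_le
      _ = β ^ r * s ^ p + β ^ (r + 1) * s ^ p * law V n φ ε {ω | phaseStep G ω σ w = none} := by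
          rw [lintegral_add_left measurable_const, lintegral_indicator_const
            (measurableSet_seeds _)]
          simp
      _ ≤ β ^ r * s ^ p + β ^ (r + 1) * s ^ p * s ^ 2 := by gcongr
      _ = β ^ r * s ^ p * (1 + s ^ 2 * β) := by ring
      _ ≤ β ^ r * s ^ p * (β * s) := by gcongr
      _ = β ^ (r + 1) * s ^ (p + 1) := by ring

/-- A bound for the probability that some station does not have the message after `p` phases. -/
lemma law_exists_uninformed_le [Fintype V] (hG : G.Connected) (hs : s ≤ 1) (hβ1 : 1 ≤ β)
    (hβ : 1 + s ^ 2 * β ≤ β * s)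
    (hfail : ∀ (σ : V → Option ℕ) (w : V), σ w = none →
      (∃ u, G.Adj w u ∧ ∃ j : Fin (reps n φ ε), σ u = some j.val) →
      law V n φ ε {ω | phaseStep G ω σ w = none} ≤ s ^ 2)
    (p : ℕ) : ∀ {σ : V → Option ℕ}, (∃ u, σ u ≠ none) →
    law V n φ ε {ω | ∃ v, (phaseStep G ω)^[p] σ v = none} ≤
      ∑ v, (missPotential G (reps n φ ε) s σ v + slowPotential G s β p σ v) := by
  induction p with
  | zero =>
    intro σ hσ
    simp only [Function.iterate_zero, id]
    by_cases h : ∃ v, σ v = none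
    · obtain ⟨v, hv⟩ := h
      -- With no phase left, the slow potential of an uninformed station is a power of `β ≥ 1`, so
      -- the bound is trivial.
      calc _ ≤ 1 := prob_le_one
        _ ≤ slowPotential G s β 0 σ v := by
          unfold slowPotential
          rw [if_pos hv, pow_zero, mul_one]
          exact one_le_pow₀ hβ1
        _ ≤ missPotential G (reps n φ ε) s σ v + slowPotential G s β 0 σ v := le_add_self
        _ ≤ _ := Finset.single_le_sum (f := fun v => missPotential G (reps n φ ε) s σ v +
          slowPotential G s β 0 σ v) (fun _ _ => zero_le) (Finset.mem_univ v)
    · simp [h]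
  | succ p ih =>
    intro σ hσ
    by_cases hlive : ∀ w, σ w = none → oldest G σ w < reps n φ ε
    · rw [law_iterate_succ G σ p fun τ => ∃ v, τ v = none]
      calc _ ≤ ∫⁻ ω, ∑ v, (missPotential G (reps n φ ε) s (phaseStep G ω σ) v +
            slowPotential G s β p (phaseStep G ω σ) v) ∂law V n φ ε := by
            refine lintegral_mono fun ω => ih ?_
            obtain ⟨u, hu⟩ := hσ
            exact ⟨u, phaseStep_ne_none ω hu⟩
        _ = ∑ v, (∫⁻ ω, missPotential G (reps n φ ε) s (phaseStep G ω σ) v ∂law V n φ ε +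
            ∫⁻ ω, slowPotential G s β p (phaseStep G ω σ) v ∂law V n φ ε) := by
            rw [lintegral_finsetSum _ fun _ _ => measurable_seeds _]
            exact Finset.sum_congr rfl fun v _ => lintegral_add_left (measurable_seeds _) _
        _ ≤ _ := Finset.sum_le_sum fun v _ => add_le_add
            (lintegral_missPotential_le hs hfail (hlive v))
            (lintegral_slowPotential_le hG hβ1 hβ hfail hσ hlive p v)
    -- Some neighbour of `w` has used up its iterations: the potential of `w` is already 1 and the
    -- bound is trivial.
    · push Not at hlive
      obtain ⟨w, hw, hR⟩ := hlive
      calc _ ≤ 1 := prob_le_one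
        _ ≤ missPotential G (reps n φ ε) s σ w := by
          unfold missPotential
          rw [if_pos hw, Nat.sub_eq_zero_of_le hR, pow_zero]
        _ ≤ missPotential G (reps n φ ε) s σ w + slowPotential G s β (p + 1) σ w := le_self_add
        _ ≤ _ := Finset.single_le_sum (f := fun v => missPotential G (reps n φ ε) s σ v +
          slowPotential G s β (p + 1) σ v) (fun _ _ => zero_le) (Finset.mem_univ w)

end Potential

end GGB

/-! ### Balls into bins -/

namespace BallsIntoBins

section Count

variable {V β : Type*} [Fintype V] [DecidableEq V] [Fintype β] [DecidableEq β]

/-- The ways to throw the balls `J` into the bins `S` such that no bin gets exactly one ball. -/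
def noSingle (J : Finset V) (S : Finset β) : Finset (V → Option β) :=
  Finset.univ.filter fun f => (∀ u ∉ J, f u = none) ∧ (∀ u ∈ J, ∃ b ∈ S, f u = some b) ∧
    ∀ b ∈ S, (Finset.univ.filter fun u => f u = some b).card ≠ 1

/-- Classify by the set `C` of balls in bin `s`; the remaining balls form an allocation to `S`
without singletons. -/
lemma card_noSingle_insert_le {S : Finset β} {s : β} (hs : s ∉ S) (J : Finset V) :
    (noSingle J (insert s S)).card ≤
      ∑ C ∈ J.powerset, if C.card = 1 then 0 else (noSingle (J \ C) S).card := by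
  classical
  have h1 : ∑ C ∈ J.powerset, (if C.card = 1 then 0 else (noSingle (J \ C) S).card) =
      ((J.powerset.filter fun C => C.card ≠ 1).sigma fun C => noSingle (J \ C) S).card := by
    rw [Finset.card_sigma, Finset.sum_filter]
    exact Finset.sum_congr rfl fun C _ => by split_ifs <;> simp_all
  rw [h1]
  refine Finset.card_le_card_of_injOn
    (fun f => ⟨Finset.univ.filter fun u => f u = some s,
      fun u => if f u = some s then none else f u⟩) ?_ ?_
  · intro f hf
    obtain ⟨hf1, hf2, hf3⟩ := (Finset.mem_filter.1 hf).2
    simp only [Finset.coe_sigma, Set.mem_sigma_iff, Finset.mem_coe, Finset.mem_filter,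
      Finset.mem_powerset, noSingle, Finset.mem_univ, true_and, Finset.mem_sdiff]
    refine ⟨⟨?_, hf3 s (Finset.mem_insert_self _ _)⟩, ?_, ?_, ?_⟩
    · intro u hu
      by_contra hJ
      rw [Finset.mem_filter, hf1 u hJ] at hu
      simp at hu
    · intro u hu
      split_ifs with h
      · rfl
      · exact hf1 u fun hJ => hu ⟨hJ, h⟩
    · rintro u ⟨hJ, h⟩
      obtain ⟨b, hb, hfb⟩ := hf2 u hJ
      refine ⟨b, (Finset.mem_insert.1 hb).resolve_left ?_, by rw [if_neg h, hfb]⟩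
      rintro rfl
      exact h hfb
    · intro b hb
      have hbs : b ≠ s := fun e => hs (e ▸ hb)
      have hfil : (Finset.univ.filter fun u => (if f u = some s then none else f u) = some b) =
          Finset.univ.filter fun u => f u = some b := by
        refine Finset.filter_congr fun u _ => ?_
        by_cases h : f u = some s
        · simp [h, hbs.symm]
        · simp [h]
      rw [hfil]
      exact hf3 b (Finset.mem_insert_of_mem hb)
  · intro f _ g _ hfg
    simp only [Sigma.mk.injEq, heq_eq_eq] at hfg
    obtain ⟨h1, h2⟩ := hfg
    funext u
    have h3 : f u = some s ↔ g u = some s := by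
      have := congrArg (u ∈ ·) h1
      simpa using this
    have h4 : (if f u = some s then none else f u) = if g u = some s then none else g u :=
      congrFun h2 u
    by_cases h : f u = some s
    · rw [h, h3.1 h]
    · rwa [if_neg h, if_neg (mt h3.2 h)] at h4

lemma sum_pow_div_factorial_ne_one_le {x : ℝ} (hx : 0 ≤ x) (j : ℕ) :
    ∑ c ∈ Finset.range (j + 1), (if c = 1 then 0 else x ^ c / (c.factorial : ℝ)) ≤
      Real.exp x - x := by
  have h1 : ∑ c ∈ Finset.range (j + 2), (if c = 1 then 0 else x ^ c / (c.factorial : ℝ)) =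
      ∑ c ∈ Finset.range (j + 2), x ^ c / (c.factorial : ℝ) - x := by
    have h2 : ∀ c, (if c = 1 then 0 else x ^ c / (c.factorial : ℝ)) =
        x ^ c / (c.factorial : ℝ) - if c = 1 then x else 0 := by
      intro c; split_ifs with h
      · simp [h]
      · simp
    simp only [h2]
    rw [Finset.sum_sub_distrib]
    simp
  -- One more term ensures that `c = 1` lies in the range even for `j = 0`.
  calc _ ≤ ∑ c ∈ Finset.range (j + 2), (if c = 1 then 0 else x ^ c / (c.factorial : ℝ)) :=
        Finset.sum_le_sum_of_subset_of_nonneg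
          (Finset.range_subset_range.2 (by omega))
          fun c _ _ => by split_ifs <;> positivity
    _ ≤ _ := by rw [h1]; linarith [Real.sum_le_exp_of_nonneg hx (j + 2)]

/-- A single bin has exponential generating function e^x - x, the linear term being forbidden, and
bins multiply. Coefficients are nonnegative, so each is bounded through the value at any `x ≥ 0`. -/
lemma card_noSingle_mul_pow_le {x : ℝ} (hx : 0 ≤ x) (S : Finset β) : ∀ J : Finset V,
    ((noSingle J S).card : ℝ) * x ^ J.card ≤
      (J.card.factorial : ℝ) * (Real.exp x - x) ^ S.card := by
  have hy : 0 ≤ Real.exp x - x := by linarith [Real.add_one_le_exp x]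
  induction S using Finset.induction_on with
  | empty =>
    intro J
    rcases J.eq_empty_or_nonempty with rfl | ⟨u, hu⟩
    · have h : (noSingle (∅ : Finset V) (∅ : Finset β)).card ≤ 1 := by
        refine Finset.card_le_one.2 fun f hf g hg => funext fun u => ?_
        rw [(Finset.mem_filter.1 hf).2.1 u (by simp), (Finset.mem_filter.1 hg).2.1 u (by simp)]
      simpa using h
    · have h : noSingle J (∅ : Finset β) = ∅ := by
        refine Finset.eq_empty_of_forall_notMem fun f hf => ?_
        obtain ⟨b, hb, -⟩ := (Finset.mem_filter.1 hf).2.2.1 u hu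
        simp at hb
      rw [h]
      simp only [Finset.card_empty, Nat.cast_zero, zero_mul, pow_zero, mul_one]
      positivity
  | insert s S hs ih =>
    intro J
    set y := Real.exp x - x with hy_def
    set j := J.card with hj
    calc ((noSingle J (insert s S)).card : ℝ) * x ^ j
        ≤ ((∑ C ∈ J.powerset, if C.card = 1 then 0 else (noSingle (J \ C) S).card : ℕ) : ℝ) *
            x ^ j := by
          gcongr
          exact card_noSingle_insert_le hs J
      _ = ∑ C ∈ J.powerset, (if C.card = 1 then 0 else
            ((noSingle (J \ C) S).card : ℝ) * x ^ j) := by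
          push_cast
          rw [Finset.sum_mul]
          exact Finset.sum_congr rfl fun C _ => by split_ifs <;> simp
      _ ≤ ∑ C ∈ J.powerset, (if C.card = 1 then 0 else
            x ^ C.card * (((j - C.card).factorial : ℝ) * y ^ S.card)) := by
          refine Finset.sum_le_sum fun C hC => ?_
          have hCJ := Finset.mem_powerset.1 hC
          split_ifs
          · exact le_rfl
          · have h1 := ih (J \ C)
            rw [Finset.card_sdiff_of_subset hCJ, ← hj] at h1
            have h2 : x ^ j = x ^ C.card * x ^ (j - C.card) := by
              rw [← pow_add, Nat.add_sub_cancel' (Finset.card_le_card hCJ)]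
            rw [h2]
            calc _ = x ^ C.card * (((noSingle (J \ C) S).card : ℝ) * x ^ (j - C.card)) := by ring
              _ ≤ _ := by gcongr
      _ = ∑ c ∈ Finset.range (j + 1), (j.choose c : ℝ) * (if c = 1 then 0 else
            x ^ c * (((j - c).factorial : ℝ) * y ^ S.card)) := by
          rw [Finset.sum_powerset_apply_card (fun c => if c = 1 then (0 : ℝ) else
            x ^ c * (((j - c).factorial : ℝ) * y ^ S.card))]
          simp only [nsmul_eq_mul, ← hj]
      _ = ∑ c ∈ Finset.range (j + 1), (j.factorial : ℝ) * y ^ S.card *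
            (if c = 1 then 0 else x ^ c / (c.factorial : ℝ)) := by
          refine Finset.sum_congr rfl fun c hc => ?_
          split_ifs
          · simp
          · have hcj : c ≤ j := Nat.lt_succ_iff.1 (Finset.mem_range.1 hc)
            have h3 : ((j.choose c : ℕ) : ℝ) * (c.factorial : ℝ) * ((j - c).factorial : ℝ) =
                (j.factorial : ℝ) := by
              exact_mod_cast Nat.choose_mul_factorial_mul_factorial hcj
            have h4 : (c.factorial : ℝ) ≠ 0 := by positivity
            rw [← h3]
            field_simp
      _ ≤ (j.factorial : ℝ) * y ^ S.card * y := by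
          rw [← Finset.mul_sum]
          gcongr
          exact sum_pow_div_factorial_ne_one_le hx j
      _ = (j.factorial : ℝ) * y ^ (insert s S).card := by
          rw [Finset.card_insert_of_notMem hs, pow_succ]; ring

/-- The balls outside `J` are free, which accounts for the power of `Fintype.card β`. -/
lemma card_not_existsUnique_le (J : Finset V)
    [DecidablePred fun f : V → β => ∀ b, ¬ ∃! u, u ∈ J ∧ f u = b] :
    (Finset.univ.filter fun f : V → β => ∀ b, ¬ ∃! u, u ∈ J ∧ f u = b).card ≤
      (noSingle J (Finset.univ : Finset β)).card *
        Fintype.card β ^ (Fintype.card V - J.card) := by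
  have h : (noSingle J (Finset.univ : Finset β)).card *
      Fintype.card β ^ (Fintype.card V - J.card) =
      (noSingle J (Finset.univ : Finset β) ×ˢ
        (Finset.univ : Finset ({u // u ∉ J} → β))).card := by
    rw [Finset.card_product, Finset.card_univ, Fintype.card_fun, Fintype.card_subtype_compl]
    simp
  rw [h]
  refine Finset.card_le_card_of_injOn
    (fun f => (fun u => if u ∈ J then some (f u) else none, fun u => f u)) ?_ ?_
  · intro f hf
    simp only [Finset.coe_product, Finset.coe_univ, Set.mem_prod, Set.mem_univ, and_true,
      Finset.mem_coe]
    refine Finset.mem_filter.2 ⟨Finset.mem_univ _, fun u hu => if_neg hu,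
      fun u hu => ⟨f u, Finset.mem_univ _, if_pos hu⟩, fun b _ hb => ?_⟩
    refine (Finset.mem_filter.1 hf).2 b ?_
    obtain ⟨u, hu⟩ := Finset.card_eq_one.1 hb
    have hmem : ∀ v, (v ∈ J ∧ f v = b) ↔ v = u := by
      intro v
      have h2 : v ∈ (Finset.univ.filter fun u => (if u ∈ J then some (f u) else none) = some b) ↔
          v = u := by
        rw [← Finset.mem_singleton, ← hu]
      rw [← h2, Finset.mem_filter]
      by_cases hv : v ∈ J <;> simp [hv]
    exact ⟨u, (hmem u).2 rfl, fun v hv => (hmem v).1 hv⟩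
  · intro f _ g _ hfg
    obtain ⟨h1, h2⟩ := Prod.mk.inj hfg
    funext u
    by_cases hu : u ∈ J
    · have := congrFun h1 u
      simpa [hu] using this
    · exact congrFun h2 ⟨u, hu⟩

lemma measure_not_existsUnique_le {k : ℕ} [NeZero k] (J : Finset V) {x : ℝ} (hx : 0 < x) :
    (Measure.pi fun _ : V => uniformOn (Set.univ : Set (Fin k)))
      {f | ∀ b, ¬ ∃! u, u ∈ J ∧ f u = b} ≤
      ENNReal.ofReal ((J.card.factorial : ℝ) * (Real.exp x - x) ^ k / (x * k) ^ J.card) := by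
  classical
  have hk : (0 : ℝ) < k := Nat.cast_pos.2 (NeZero.pos k)
  rw [← uniformOn_pi, Set.pi_univ, uniformOn_univ]
  have hset : ({f | ∀ b, ¬ ∃! u, u ∈ J ∧ f u = b} : Set (V → Fin k)) =
      ((Finset.univ.filter fun f : V → Fin k => ∀ b, ¬ ∃! u, u ∈ J ∧ f u = b :
        Finset (V → Fin k)) : Set (V → Fin k)) := by
    ext f; simp
  rw [hset, Measure.count_apply_finset]
  have hcard := card_not_existsUnique_le (β := Fin k) J
  have hGF := card_noSingle_mul_pow_le (β := Fin k) hx.le Finset.univ J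
  rw [Finset.card_univ, Fintype.card_fin] at hGF
  rw [Fintype.card_fin] at hcard
  have hJ : J.card ≤ Fintype.card V := Finset.card_le_univ J
  set c := (Finset.univ.filter fun f : V → Fin k => ∀ b, ¬ ∃! u, u ∈ J ∧ f u = b).card
  have hc : (c : ENNReal) / (Fintype.card (V → Fin k) : ℕ) =
      ENNReal.ofReal ((c : ℝ) / (k : ℝ) ^ Fintype.card V) := by
    rw [ENNReal.ofReal_div_of_pos (by positivity), ENNReal.ofReal_natCast, Fintype.card_fun,
      Fintype.card_fin, ENNReal.ofReal_pow hk.le, ENNReal.ofReal_natCast, Nat.cast_pow]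
  rw [hc]
  refine ENNReal.ofReal_le_ofReal ?_
  have hcard' : (c : ℝ) ≤ ((noSingle J (Finset.univ : Finset (Fin k))).card : ℝ) *
      (k : ℝ) ^ (Fintype.card V - J.card) := by exact_mod_cast hcard
  have hsplit : (k : ℝ) ^ Fintype.card V =
      (k : ℝ) ^ (Fintype.card V - J.card) * (k : ℝ) ^ J.card := by
    rw [← pow_add, Nat.sub_add_cancel hJ]
  rw [div_le_div_iff₀ (by positivity) (by positivity), mul_pow]
  calc (c : ℝ) * (x ^ J.card * (k : ℝ) ^ J.card)
      ≤ ((noSingle J (Finset.univ : Finset (Fin k))).card : ℝ) *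
        (k : ℝ) ^ (Fintype.card V - J.card) * (x ^ J.card * (k : ℝ) ^ J.card) := by gcongr
    _ = ((noSingle J (Finset.univ : Finset (Fin k))).card : ℝ) * x ^ J.card *
        (k : ℝ) ^ Fintype.card V := by rw [hsplit]; ring
    _ ≤ _ := by gcongr

end Count

/-! ### Estimates of the generating function bound for few and for many balls -/

lemma two_mul_pow_self_le {j : ℕ} (hj : 1 ≤ j) : 2 * (j : ℝ) ^ j ≤ ((j : ℝ) + 1) ^ j := by
  have hj' : (0 : ℝ) < j := by exact_mod_cast hj
  have h := one_add_mul_le_pow (a := 1 / (j : ℝ)) (by have := one_div_pos.2 hj'; linarith) j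
  have h2 : ((j : ℝ) + 1) ^ j = (j : ℝ) ^ j * (1 + 1 / (j : ℝ)) ^ j := by
    rw [← mul_pow]; congr 1; field_simp
  have h3 : 1 + (j : ℝ) * (1 / (j : ℝ)) = 2 := by field_simp; norm_num
  rw [h2]
  rw [h3] at h
  nlinarith [pow_pos hj' j]

/-- Equality holds at `j = 2`. The inductive step uses e ≤ 4 and `4 * (j + 1) ≤ k`. -/
lemma factorial_sq_mul_le {k : ℝ} {j : ℕ} (hj : 2 ≤ j) (hk : 4 * (j : ℝ) ≤ k) :
    (j.factorial : ℝ) ^ 2 * (2 * Real.exp 1) ^ j * k ^ 2 ≤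
      (2 * Real.exp 1) ^ 2 * (j * k) ^ j := by
  induction j, hj using Nat.le_induction with
  | base => norm_num [Nat.factorial]; nlinarith
  | succ j hj ih =>
    rw [Nat.factorial_succ]
    push_cast at hk ⊢
    have hj0 : (0 : ℝ) ≤ j := by positivity
    have hk0 : 0 < k := by linarith
    have he : Real.exp 1 ≤ 4 := by linarith [Real.exp_one_lt_d9]
    have h1 := two_mul_pow_self_le (j := j) (by omega)
    have h2 : ((j : ℝ) + 1) ^ 2 * (2 * Real.exp 1) * (j * k) ^ j ≤
        (((j : ℝ) + 1) * k) ^ (j + 1) := by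
      calc ((j : ℝ) + 1) ^ 2 * (2 * Real.exp 1) * (j * k) ^ j
          = (Real.exp 1 * (j + 1)) * (2 * (j : ℝ) ^ j) * (k ^ j * (j + 1)) := by
            rw [mul_pow]; ring
        _ ≤ (4 * (j + 1)) * ((j : ℝ) + 1) ^ j * (k ^ j * (j + 1)) := by gcongr
        _ ≤ k * ((j : ℝ) + 1) ^ j * (k ^ j * (j + 1)) := by gcongr
        _ = _ := by rw [mul_pow]; ring
    calc (((j : ℝ) + 1) * (j.factorial : ℝ)) ^ 2 * (2 * Real.exp 1) ^ (j + 1) * k ^ 2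
        = ((j : ℝ) + 1) ^ 2 * (2 * Real.exp 1) *
          ((j.factorial : ℝ) ^ 2 * (2 * Real.exp 1) ^ j * k ^ 2) := by ring
      _ ≤ ((j : ℝ) + 1) ^ 2 * (2 * Real.exp 1) * ((2 * Real.exp 1) ^ 2 * (j * k) ^ j) := by
        exact mul_le_mul_of_nonneg_left (ih (by linarith)) (by positivity)
      _ = (2 * Real.exp 1) ^ 2 * (((j : ℝ) + 1) ^ 2 * (2 * Real.exp 1) * (j * k) ^ j) := by ring
      _ ≤ _ := by gcongr

lemma exp_sub_self_le {x : ℝ} (h0 : 0 ≤ x) (h1 : x ≤ 1) : Real.exp x - x ≤ Real.exp (x ^ 2) := by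
  have h2 := (abs_le.1 (Real.abs_exp_sub_one_sub_id_le (x := x) (by rwa [abs_of_nonneg h0]))).2
  linarith [Real.add_one_le_exp (x ^ 2)]

/-- Here x^2 = j/(2k), so e^x - x ≤ exp(x^2) makes the square of the k-th power at most e^j.
Squaring removes the root and reduces the claim to `factorial_sq_mul_le`; 6 comes from 2e < 6. -/
lemma genfun_few_le {k j : ℕ} (hj : 2 ≤ j) (hk : 4 * j ≤ k) :
    (j.factorial : ℝ) * (Real.exp √(j / (2 * k)) - √(j / (2 * k))) ^ k /
      (√(j / (2 * k)) * k) ^ j ≤ 6 / k := by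
  have hj0 : (0 : ℝ) < j := by exact_mod_cast (by omega : 0 < j)
  have hk0 : (0 : ℝ) < k := by exact_mod_cast (by omega : 0 < k)
  have hk' : 4 * (j : ℝ) ≤ k := by exact_mod_cast hk
  set x := √((j : ℝ) / (2 * k)) with hx
  have hx0 : 0 < x := Real.sqrt_pos.2 (by positivity)
  have hx2 : x ^ 2 = j / (2 * k) := Real.sq_sqrt (by positivity)
  have hx1 : x ≤ 1 := by
    rw [hx, Real.sqrt_le_left (by norm_num), one_pow, div_le_one (by positivity)]
    linarith
  have hy0 : 0 ≤ Real.exp x - x := by linarith [Real.add_one_le_exp x]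
  refine le_of_abs_le (abs_le_of_sq_le_sq ?_ (by positivity))
  have hpow : ((Real.exp x - x) ^ k) ^ 2 ≤ Real.exp 1 ^ j := by
    calc ((Real.exp x - x) ^ k) ^ 2 ≤ (Real.exp (x ^ 2) ^ k) ^ 2 := by
          gcongr; exact exp_sub_self_le hx0.le hx1
      _ = Real.exp 1 ^ j := by
          rw [← Real.exp_nat_mul, ← Real.exp_nat_mul, ← Real.exp_nat_mul, hx2]
          congr 1; push_cast; field_simp
  have hden : ((x * k) ^ j) ^ 2 * 2 ^ j = ((j : ℝ) * k) ^ j := by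
    have h : (x * k) ^ 2 * 2 = j * k := by rw [mul_pow, hx2]; field_simp
    rw [← pow_mul, mul_comm j 2, pow_mul, ← mul_pow, h]
  have hmain := factorial_sq_mul_le hj hk'
  have he : (2 * Real.exp 1) ^ 2 ≤ 6 ^ 2 := by
    have := Real.exp_one_lt_d9
    have := Real.exp_pos 1
    gcongr; linarith
  rw [div_pow, div_pow, div_le_div_iff₀ (by positivity) (by positivity)]
  refine le_of_mul_le_mul_right (a := (2 : ℝ) ^ j) ?_ (by positivity)
  calc ((j.factorial : ℝ) * (Real.exp x - x) ^ k) ^ 2 * (k : ℝ) ^ 2 * 2 ^ j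
      = (j.factorial : ℝ) ^ 2 * ((Real.exp x - x) ^ k) ^ 2 * (k : ℝ) ^ 2 * 2 ^ j := by ring
    _ ≤ (j.factorial : ℝ) ^ 2 * Real.exp 1 ^ j * (k : ℝ) ^ 2 * 2 ^ j := by gcongr
    _ = (j.factorial : ℝ) ^ 2 * (2 * Real.exp 1) ^ j * (k : ℝ) ^ 2 := by rw [mul_pow]; ring
    _ ≤ (2 * Real.exp 1) ^ 2 * (j * k) ^ j := hmain
    _ ≤ 6 ^ 2 * (j * k) ^ j := by gcongr
    _ = _ := by rw [← hden]; ring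

lemma factorial_mul_exp_le {j : ℕ} (hj : 1 ≤ j) :
    (j.factorial : ℝ) * Real.exp j ≤ Real.exp 1 * j * (j : ℝ) ^ j := by
  induction j, hj using Nat.le_induction with
  | base => simp
  | succ j hj ih =>
    have hj0 : (0 : ℝ) < j := by exact_mod_cast hj
    rw [Nat.factorial_succ]
    push_cast
    have h1 : Real.exp 1 * (j : ℝ) ^ (j + 1) ≤ ((j : ℝ) + 1) ^ (j + 1) := by
      have h2 : Real.exp (-(1 / ((j : ℝ) + 1))) ≥ j / (j + 1) := by
        have := Real.add_one_le_exp (-(1 / ((j : ℝ) + 1)))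
        have h3 : (j : ℝ) / (j + 1) = -(1 / ((j : ℝ) + 1)) + 1 := by field_simp; ring
        rw [h3]; exact this
      have h4 : ((j : ℝ) / (j + 1)) ^ (j + 1) ≤ Real.exp (-1) := by
        calc _ ≤ Real.exp (-(1 / ((j : ℝ) + 1))) ^ (j + 1) := by gcongr
          _ = Real.exp (-1) := by
            rw [← Real.exp_nat_mul]; congr 1; push_cast; field_simp
      rw [div_pow, div_le_iff₀ (by positivity), Real.exp_neg] at h4
      have := Real.exp_pos 1
      calc _ ≤ Real.exp 1 * ((Real.exp 1)⁻¹ * ((j : ℝ) + 1) ^ (j + 1)) := by gcongr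
        _ = _ := by field_simp
    calc ((j : ℝ) + 1) * (j.factorial : ℝ) * Real.exp (j + 1)
        = ((j : ℝ) + 1) * Real.exp 1 * ((j.factorial : ℝ) * Real.exp j) := by
          rw [Real.exp_add]; ring
      _ ≤ ((j : ℝ) + 1) * Real.exp 1 * (Real.exp 1 * j * (j : ℝ) ^ j) := by gcongr
      _ = ((j : ℝ) + 1) * Real.exp 1 * (Real.exp 1 * (j : ℝ) ^ (j + 1)) := by ring
      _ ≤ ((j : ℝ) + 1) * Real.exp 1 * ((j : ℝ) + 1) ^ (j + 1) := by gcongr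
      _ = _ := by ring

/-- Write e^x - x = e^x (1 - x e^(-x)) ≤ exp(x - x e^(-x)) at x = j/k; the factor e^j is absorbed by
the Stirling-type bound `factorial_mul_exp_le`. -/
lemma genfun_le {k j : ℕ} (hj : 1 ≤ j) (hk : 0 < k) :
    (j.factorial : ℝ) * (Real.exp (j / k) - j / k) ^ k / ((j / k : ℝ) * k) ^ j ≤
      Real.exp 1 * j * Real.exp (-(j * Real.exp (-(j / k)))) := by
  have hj0 : (0 : ℝ) < j := by exact_mod_cast hj
  have hk0 : (0 : ℝ) < k := by exact_mod_cast hk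
  set x : ℝ := j / k with hx
  have hxk : x * k = j := by rw [hx]; field_simp
  have hy0 : 0 ≤ Real.exp x - x := by linarith [Real.add_one_le_exp x]
  have h1 : Real.exp x - x ≤ Real.exp (x - x * Real.exp (-x)) := by
    have h2 := Real.add_one_le_exp (-(x * Real.exp (-x)))
    have h3 : Real.exp x * Real.exp (-x) = 1 := by rw [← Real.exp_add]; simp
    rw [sub_eq_add_neg x (x * _), Real.exp_add]
    calc Real.exp x - x = Real.exp x * (-(x * Real.exp (-x)) + 1) := by
          linear_combination x * h3
      _ ≤ _ := by gcongr
  have h4 : (Real.exp x - x) ^ k ≤ Real.exp j * Real.exp (-(j * Real.exp (-x))) := by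
    calc _ ≤ Real.exp (x - x * Real.exp (-x)) ^ k := by gcongr
      _ = _ := by
        rw [← Real.exp_nat_mul, ← Real.exp_add]
        congr 1
        rw [← hxk]; ring
  rw [hxk, div_le_iff₀ (by positivity)]
  calc (j.factorial : ℝ) * (Real.exp x - x) ^ k
      ≤ (j.factorial : ℝ) * (Real.exp j * Real.exp (-(j * Real.exp (-x)))) := by gcongr
    _ = (j.factorial : ℝ) * Real.exp j * Real.exp (-(j * Real.exp (-x))) := by ring
    _ ≤ Real.exp 1 * j * (j : ℝ) ^ j * Real.exp (-(j * Real.exp (-x))) := by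
        exact mul_le_mul_of_nonneg_right (factorial_mul_exp_le hj) (Real.exp_pos _).le
    _ = _ := by ring

/-- The main estimate when the number of balls may exceed the number of bins. -/
lemma genfun_many_le {k j : ℕ} {N : ℝ} (hN : 4 ≤ N) (hk : 24 * N ≤ k) (hj : k ≤ 4 * j)
    (hjN : (j : ℝ) ≤ 8 * N * Real.log N) :
    Real.exp 1 * j * Real.exp (-(j * Real.exp (-(j / k)))) ≤ 1 / (4 * N) := by
  have hN0 : 0 < N := by linarith
  have hk0 : (0 : ℝ) < k := by linarith
  have hj' : (k : ℝ) ≤ 4 * j := by exact_mod_cast hj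
  have hj0 : 6 * N ≤ j := by linarith
  set z := Real.exp (Real.log N / 3) with hz
  have hz3 : z ^ 3 = N := by
    rw [hz, ← Real.exp_nat_mul]
    have : ((3 : ℕ) : ℝ) * (Real.log N / 3) = Real.log N := by push_cast; ring
    rw [this, Real.exp_log hN0]
  have hz0 : 0 < z := Real.exp_pos _
  have hz1 : 1.5 ≤ z := by
    by_contra h
    push Not at h
    have : z ^ 3 ≤ 1.5 ^ 3 := by gcongr
    norm_num at this
    linarith
  -- The 24 in `k` makes j/k at most (ln N)/3, so a ball is lost to crowding only up to a factor z =
  -- N^(1/3).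
  have hexp : z⁻¹ ≤ Real.exp (-(j / k)) := by
    rw [hz, ← Real.exp_neg, Real.exp_le_exp, neg_le_neg_iff, div_le_iff₀ hk0]
    have hlog : 0 ≤ Real.log N := Real.log_nonneg (by linarith)
    calc (j : ℝ) ≤ 8 * N * Real.log N := hjN
      _ = Real.log N / 3 * (24 * N) := by ring
      _ ≤ Real.log N / 3 * k := by gcongr
  have hmain : 6 * z ^ 2 ≤ j * Real.exp (-(j / k)) := by
    calc 6 * z ^ 2 = 6 * N * z⁻¹ := by rw [← hz3]; field_simp
      _ ≤ _ := by gcongr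
  have hlogN : Real.log N ≤ N := (Real.log_le_sub_one_of_pos hN0).trans (by linarith)
  have hjsq : (j : ℝ) ≤ 8 * N ^ 2 := by
    calc (j : ℝ) ≤ 8 * N * Real.log N := hjN
      _ ≤ 8 * N * N := by gcongr
      _ = _ := by ring
  -- The fifth term of the exponential series is 64.8 z^10, and z ≥ 1.5 makes this at least 96 z^9.
  have hE : 96 * N ^ 3 ≤ Real.exp (6 * z ^ 2) := by
    have h1 := Real.pow_div_factorial_le_exp (6 * z ^ 2) (by positivity) 5
    have h2 : ((5 : ℕ).factorial : ℝ) = 120 := by norm_num [Nat.factorial]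
    rw [h2] at h1
    refine le_trans ?_ h1
    rw [← hz3, le_div_iff₀ (by norm_num)]
    have h3 : (6 * z ^ 2) ^ 5 = 7776 * z ^ 9 * z := by ring
    rw [h3]
    nlinarith [pow_pos hz0 9]
  rw [Real.exp_neg, ← div_eq_mul_inv, div_le_div_iff₀ (Real.exp_pos _) (by positivity), one_mul]
  have he : Real.exp 1 ≤ 3 := by linarith [Real.exp_one_lt_d9]
  calc Real.exp 1 * j * (4 * N) ≤ 3 * (8 * N ^ 2) * (4 * N) := by gcongr
    _ = 96 * N ^ 3 := by ring
    _ ≤ Real.exp (6 * z ^ 2) := hE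
    _ ≤ _ := Real.exp_le_exp.2 hmain

section Measure

variable {V : Type*} [Fintype V] {k : ℕ} [NeZero k]

lemma measure_not_existsUnique_few_le {J : Finset V} (hJ : J.Nonempty) (hk : 4 * J.card ≤ k) :
    (Measure.pi fun _ : V => uniformOn (Set.univ : Set (Fin k)))
      {f | ∀ b, ¬ ∃! u, u ∈ J ∧ f u = b} ≤ ENNReal.ofReal (6 / k) := by
  classical
  have hJ1 := hJ.card_pos
  -- A lone ball is always a singleton; the analytic bound needs two balls.
  rcases (by omega : J.card = 1 ∨ 2 ≤ J.card) with h1 | h2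
  · obtain ⟨u, rfl⟩ := Finset.card_eq_one.1 h1
    have : ({f | ∀ b, ¬ ∃! v, v ∈ ({u} : Finset V) ∧ f v = b} : Set (V → Fin k)) = ∅ := by
      refine Set.eq_empty_of_forall_notMem fun f hf => hf (f u) ?_
      exact ⟨u, by simp, fun v hv => by simpa using hv.1⟩
    rw [this]
    simp
  · refine (measure_not_existsUnique_le J (x := √(J.card / (2 * k))) ?_).trans
      (ENNReal.ofReal_le_ofReal (genfun_few_le h2 hk))
    have : 0 < k := NeZero.pos k
    exact Real.sqrt_pos.2 (by positivity)

/-- The probability that no bin gets exactly one of the balls `J`. -/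
lemma measure_not_existsUnique_many_le {J : Finset V} (hJ : J.Nonempty) {N : ℝ} (hN : 4 ≤ N)
    (hk : 24 * N ≤ k) (hJN : (J.card : ℝ) ≤ 8 * N * Real.log N) :
    (Measure.pi fun _ : V => uniformOn (Set.univ : Set (Fin k)))
      {f | ∀ b, ¬ ∃! u, u ∈ J ∧ f u = b} ≤ ENNReal.ofReal (1 / (4 * N)) := by
  classical
  rcases le_total (4 * J.card) k with h | h
  · refine (measure_not_existsUnique_few_le hJ h).trans (ENNReal.ofReal_le_ofReal ?_)
    rw [div_le_div_iff₀ (by linarith) (by linarith)]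
    linarith
  · have hk0 : 0 < k := NeZero.pos k
    have hJ1 := hJ.card_pos
    refine (measure_not_existsUnique_le J (x := J.card / k) (by positivity)).trans
      (ENNReal.ofReal_le_ofReal ?_)
    exact (genfun_le hJ1 hk0).trans (genfun_many_le hN hk h hJN)

end Measure

end BallsIntoBins

/-! ### The number of independent samples in a given set -/

section Samples

variable {V α : Type*} [Fintype V] [MeasurableSpace α] {μ : Measure α} [IsProbabilityMeasure μ]
  {Q : Set α}

lemma measure_pi_forall_notMem_le (hQ : MeasurableSet Q) {p : ℝ} (hp : ENNReal.ofReal p ≤ μ Q)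
    (A : Finset V) :
    (Measure.pi fun _ : V => μ) {x | ∀ u ∈ A, x u ∉ Q} ≤
      ENNReal.ofReal (Real.exp (-(A.card * p))) := by
  classical
  have h1 : ({x | ∀ u ∈ A, x u ∉ Q} : Set (V → α)) =
      Set.univ.pi fun u => if u ∈ A then Qᶜ else Set.univ := by
    ext x
    simp only [Set.mem_pi, Set.mem_univ, true_imp_iff]
    refine forall_congr' fun u => ?_
    by_cases hu : u ∈ A <;> simp [hu]
  have h2 : μ Qᶜ ≤ ENNReal.ofReal (Real.exp (-p)) := by
    rw [prob_compl_eq_one_sub hQ]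
    calc 1 - μ Q ≤ 1 - ENNReal.ofReal p := tsub_le_tsub_left hp 1
      _ ≤ ENNReal.ofReal (1 - p) := by
        rw [tsub_le_iff_right, ← ENNReal.ofReal_one]
        exact (ENNReal.ofReal_le_ofReal (by linarith)).trans ENNReal.ofReal_add_le
      _ ≤ _ := ENNReal.ofReal_le_ofReal (by linarith [Real.add_one_le_exp (-p)])
  rw [h1, Measure.pi_pi]
  calc ∏ u, μ (if u ∈ A then Qᶜ else Set.univ) = ∏ u ∈ A, μ Qᶜ := by
        rw [← Finset.prod_subset (Finset.subset_univ A)]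
        · exact Finset.prod_congr rfl fun u hu => by rw [if_pos hu]
        · intro u _ hu; rw [if_neg hu, measure_univ]
    _ = μ Qᶜ ^ A.card := Finset.prod_const _
    _ ≤ ENNReal.ofReal (Real.exp (-p)) ^ A.card := by gcongr
    _ = _ := by
      rw [← ENNReal.ofReal_pow (Real.exp_pos _).le, ← Real.exp_nat_mul, mul_neg]

-- Chernoff bound with exponential moment at parameter 1: the moment of one indicator is at most 1 +
-- (e - 1)p ≤ exp(7p/4).
open Classical in
lemma measure_pi_lt_card_le (hQ : MeasurableSet Q) {p : ℝ} (hp0 : 0 ≤ p)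
    (hp : μ Q ≤ ENNReal.ofReal p) (A : Finset V) (t : ℝ) :
    (Measure.pi fun _ : V => μ) {x | t < ((A.filter fun u => x u ∈ Q).card : ℝ)} ≤
      ENNReal.ofReal (Real.exp (2 * (A.card * p) * (7 / 8) - t)) := by
  have he1 : (1 : ℝ) ≤ Real.exp 1 := Real.one_le_exp zero_le_one
  have he : Real.exp 1 - 1 ≤ 7 / 4 := by linarith [Real.exp_one_lt_d9]
  set X : α → ENNReal := fun a => 1 + Q.indicator (fun _ => ENNReal.ofReal (Real.exp 1 - 1)) a
  have hXm : Measurable X :=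
    Measurable.add (f := fun _ => (1 : ENNReal)) measurable_const (measurable_const.indicator hQ)
  have hX : ∫⁻ a, X a ∂μ ≤ ENNReal.ofReal (Real.exp (7 / 4 * p)) := by
    rw [lintegral_add_left measurable_const, lintegral_indicator_const hQ]
    simp only [lintegral_const, measure_univ, mul_one]
    calc 1 + ENNReal.ofReal (Real.exp 1 - 1) * μ Q
        ≤ ENNReal.ofReal 1 + ENNReal.ofReal (7 / 4) * ENNReal.ofReal p := by
          rw [ENNReal.ofReal_one]; gcongr
      _ = ENNReal.ofReal (1 + 7 / 4 * p) := by
          rw [← ENNReal.ofReal_mul (by norm_num), ← ENNReal.ofReal_add (by norm_num)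
            (by positivity)]
      _ ≤ _ := ENNReal.ofReal_le_ofReal (by linarith [Real.add_one_le_exp (7 / 4 * p)])
  have hint : ∫⁻ x, ∏ u ∈ A, X (x u) ∂(Measure.pi fun _ : V => μ) ≤
      ENNReal.ofReal (Real.exp (2 * (A.card * p) * (7 / 8))) := by
    rw [lintegral_prod_eq_prod_lintegral_of_indepFun A (fun u (x : V → α) => X (x u))
      (iIndepFun_pi fun _ => hXm.aemeasurable) fun u => hXm.comp (measurable_pi_apply u)]
    have h1 : ∀ u : V, ∫⁻ x, X (x u) ∂(Measure.pi fun _ : V => μ) = ∫⁻ a, X a ∂μ := fun u =>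
      (measurePreserving_eval (fun _ : V => μ) u).lintegral_comp hXm
    simp only [h1, Finset.prod_const]
    calc _ ≤ ENNReal.ofReal (Real.exp (7 / 4 * p)) ^ A.card := by gcongr
      _ = _ := by
        rw [← ENNReal.ofReal_pow (Real.exp_pos _).le, ← Real.exp_nat_mul]
        congr 2; ring
  have hprod : ∀ x : V → α, ∏ u ∈ A, X (x u) =
      ENNReal.ofReal (Real.exp ((A.filter fun u => x u ∈ Q).card)) := by
    intro x
    have h1 : ∀ u ∈ A, X (x u) = if x u ∈ Q then ENNReal.ofReal (Real.exp 1) else 1 := by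
      intro u _
      by_cases hu : x u ∈ Q
      · simp only [X, hu, Set.indicator_of_mem, if_true]
        rw [← ENNReal.ofReal_one, ← ENNReal.ofReal_add (by norm_num) (by linarith)]
        congr 1; ring
      · simp [X, hu]
    rw [Finset.prod_congr rfl h1, Finset.prod_ite]
    simp only [Finset.prod_const, one_pow, mul_one]
    rw [← ENNReal.ofReal_pow (Real.exp_pos _).le, ← Real.exp_nat_mul, mul_one]
  have hmarkov := mul_meas_ge_le_lintegral (μ := Measure.pi fun _ : V => μ)
    (f := fun x => ∏ u ∈ A, X (x u))
    (Finset.measurable_fun_prod _ fun u _ => hXm.comp (measurable_pi_apply u))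
    (ENNReal.ofReal (Real.exp t))
  have ht0 : ENNReal.ofReal (Real.exp t) ≠ 0 := by
    rw [Ne, ENNReal.ofReal_eq_zero, not_le]; exact Real.exp_pos t
  have hsub : ({x | t < ((A.filter fun u => x u ∈ Q).card : ℝ)} : Set (V → α)) ⊆
      {x | ENNReal.ofReal (Real.exp t) ≤ ∏ u ∈ A, X (x u)} := by
    intro x hx
    have hx' : t < ((A.filter fun u => x u ∈ Q).card : ℝ) := hx
    change ENNReal.ofReal (Real.exp t) ≤ ∏ u ∈ A, X (x u)
    rw [hprod]
    exact ENNReal.ofReal_le_ofReal (Real.exp_le_exp.2 hx'.le)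
  refine (measure_mono hsub).trans ?_
  rw [Real.exp_sub, ENNReal.ofReal_div_of_pos (Real.exp_pos t),
    ENNReal.le_div_iff_mul_le (Or.inl ht0) (Or.inl ENNReal.ofReal_ne_top), mul_comm]
  exact hmarkov.trans hint

end Samples

lemma ProbabilityTheory.geometricMeasure_Ici_le {p : unitInterval} (hp : p ≠ 0) (i : ℕ) :
    geometricMeasure p (Set.Ici i) ≤ ENNReal.ofReal ((1 - p) ^ i) := by
  have h1 : (geometricMeasure p).real (Set.Ici i) = (1 - p : ℝ) ^ i := by
    have hc : Set.Ici i = ((Finset.range i : Finset ℕ) : Set ℕ)ᶜ := by ext; simp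
    rw [hc, probReal_compl_eq_one_sub (Finset.measurableSet _), ← sum_measureReal_singleton]
    simp only [geometricMeasure_real_singleton hp]
    rw [← Finset.sum_mul]
    have := geom_sum_mul (1 - p : ℝ) i
    linarith
  rw [← h1, ofReal_measureReal]

namespace GGB

/-! ### Estimates for the parameters -/

section Parameters

variable {n : ℕ} {φ ε : ℝ}

lemma two_le_logb (hn : 4 ≤ n) : 2 ≤ Real.logb 2 n := by
  rw [Real.le_logb_iff_rpow_le (by norm_num) (by positivity)]
  norm_num; exact hn

lemma one_le_logb_logb (hn : 4 ≤ n) : 1 ≤ Real.logb 2 (Real.logb 2 n) := by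
  have h := two_le_logb hn
  rw [Real.le_logb_iff_rpow_le (by norm_num) (by linarith)]
  simpa using h

lemma logb_rpow_one_div (hn : 4 ≤ n) (φ : ℝ) :
    Real.logb 2 ((n : ℝ) ^ (1 / φ)) = Real.logb 2 n / φ := by
  rw [Real.logb_rpow_eq_mul_logb_of_pos (by positivity)]; ring

lemma logb_lt_rpow (hn : 4 ≤ n) (h1 : 1 ≤ φ)
    (h2 : φ < Real.logb 2 n / Real.logb 2 (Real.logb 2 n)) :
    Real.logb 2 n < (n : ℝ) ^ (1 / φ) := by
  have hL := two_le_logb hn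
  have hLL := one_le_logb_logb hn
  rw [← Real.logb_lt_logb_iff (b := 2) (by norm_num) (by linarith)
    (by have : (0 : ℝ) < n := by positivity
        positivity), logb_rpow_one_div hn, lt_div_iff₀ (by linarith)]
  rw [lt_div_iff₀ (by linarith)] at h2
  linarith

lemma lt_rpow (hn : 4 ≤ n) (h1 : 1 ≤ φ)
    (h2 : φ < Real.logb 2 n / Real.logb 2 (Real.logb 2 n)) : φ < (n : ℝ) ^ (1 / φ) :=
  (h2.trans_le (div_le_self (by linarith [two_le_logb hn]) (one_le_logb_logb hn))).trans
    (logb_lt_rpow hn h1 h2)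

lemma logb_sub_pos (hn : 4 ≤ n) (h1 : 1 ≤ φ)
    (h2 : φ < Real.logb 2 n / Real.logb 2 (Real.logb 2 n)) :
    0 < Real.logb 2 n - φ * Real.logb 2 φ := by
  have h3 := Real.logb_lt_logb (b := 2) (by norm_num) (by linarith) (lt_rpow hn h1 h2)
  rw [logb_rpow_one_div hn, lt_div_iff₀ (by linarith)] at h3
  linarith

lemma le_phase_length (hn : 4 ≤ n) (h1 : 1 ≤ φ)
    (h2 : φ < Real.logb 2 n / Real.logb 2 (Real.logb 2 n)) :
    φ ≤ φ * Real.logb 2 n / (Real.logb 2 n - φ * Real.logb 2 φ) := by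
  have h3 := logb_sub_pos hn h1 h2
  have h4 : 0 ≤ Real.logb 2 φ := Real.logb_nonneg (by norm_num) h1
  rw [le_div_iff₀ h3]
  have : 0 ≤ φ * Real.logb 2 φ := by positivity
  nlinarith

lemma a_pos (hn : 4 ≤ n) (h1 : 1 ≤ φ)
    (h2 : φ < Real.logb 2 n / Real.logb 2 (Real.logb 2 n)) : 0 < a n φ :=
  Nat.ceil_pos.2 (by linarith [le_phase_length hn h1 h2])

/-- This is the reason for the choice of `a`: in logarithms it says a (log n - φ log φ) ≥ φ log n.
-/
lemma pow_a_le (hn : 4 ≤ n) (h1 : 1 ≤ φ)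
    (h2 : φ < Real.logb 2 n / Real.logb 2 (Real.logb 2 n)) :
    (φ / (n : ℝ) ^ (1 / φ)) ^ a n φ ≤ 1 / n := by
  have hn0 : (0 : ℝ) < n := by positivity
  have hN0 : 0 < (n : ℝ) ^ (1 / φ) := by positivity
  have hφ0 : 0 < φ := by linarith
  have h3 := logb_sub_pos hn h1 h2
  have h4 : φ * Real.logb 2 n / (Real.logb 2 n - φ * Real.logb 2 φ) ≤ a n φ := Nat.le_ceil _
  rw [← Real.logb_le_logb (b := 2) (by norm_num) (by positivity) (by positivity),
    Real.logb_pow, Real.logb_div hφ0.ne' hN0.ne', logb_rpow_one_div hn, one_div, Real.logb_inv]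
  rw [div_le_iff₀ h3] at h4
  have h5 : (a n φ : ℝ) * (Real.logb 2 φ - Real.logb 2 n / φ) =
      -((a n φ : ℝ) * (Real.logb 2 n - φ * Real.logb 2 φ) / φ) := by field_simp; ring
  rw [h5, neg_le_neg_iff, le_div_iff₀ hφ0]
  linarith

lemma le_k (n : ℕ) (φ : ℝ) : 24 * (n : ℝ) ^ (1 / φ) ≤ k n φ := by
  have := Nat.le_ceil ((n : ℝ) ^ (1 / φ))
  unfold k
  push_cast
  linarith

lemma sixteen_lt (hn : 4 ≤ n) (h : 6 * Real.logb 2 n < n) : 16 < n := by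
  by_contra hle
  push Not at hle
  have h2 := two_le_logb hn
  rcases le_or_gt n 12 with h12 | h12
  · have : (n : ℝ) ≤ 12 := by exact_mod_cast h12
    linarith
  · have h3 : 3 ≤ Real.logb 2 n := by
      rw [Real.le_logb_iff_rpow_le (by norm_num) (by positivity)]
      have : (12 : ℝ) ≤ n := by exact_mod_cast h12.le
      norm_num; linarith
    have : (n : ℝ) ≤ 16 := by exact_mod_cast hle
    linarith

lemma four_le_logb (hn : 16 < n) : 4 ≤ Real.logb 2 n := by
  rw [Real.le_logb_iff_rpow_le (by norm_num) (by positivity)]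
  norm_num; exact hn.le

lemma div_rpow_le_half (hn : 16 < n) (h1 : 1 ≤ φ)
    (h2 : φ < Real.logb 2 n / Real.logb 2 (Real.logb 2 n)) :
    φ / (n : ℝ) ^ (1 / φ) ≤ 1 / 2 := by
  have h3 := logb_lt_rpow (by omega) h1 h2
  have h4 := four_le_logb hn
  have h5 : 2 ≤ Real.logb 2 (Real.logb 2 n) := by
    rw [Real.le_logb_iff_rpow_le (by norm_num) (by linarith)]
    norm_num; exact h4
  rw [lt_div_iff₀ (by linarith)] at h2
  rw [div_le_div_iff₀ (by linarith) (by norm_num)]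
  nlinarith

end Parameters

/-! ### A single phase -/

section Phase

variable {V : Type*} [Fintype V] {n : ℕ} {φ ε : ℝ}

/-- The law of the random choices of a station for one iteration. -/
noncomputable def choiceLaw (n : ℕ) (φ : ℝ) : Measure (ℕ × Fin (k n φ)) :=
  (geometricMeasure (Set.projIcc (0 : ℝ) 1 zero_le_one (1 - φ / (n : ℝ) ^ (1 / φ)))).prod
    (uniformOn Set.univ)

instance : IsProbabilityMeasure (choiceLaw n φ) := by unfold choiceLaw; infer_instance

/-- The number of the Balls-into-Bins execution in which a station takes part. -/
noncomputable def bucketOf (n : ℕ) (φ : ℝ) (x : ℕ) : ℕ := min (x + 1) (a n φ)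

open Classical in
/-- No round of a phase has exactly one transmission of a station in `A`. -/
lemma choiceLaw_fail_le {A : Finset V} {c : ENNReal} {Bad : Set (V → ℕ)} (ha : 0 < a n φ)
    (i : (V → ℕ) → ℕ)
    (hc : ∀ x ∉ Bad, (Measure.pi fun _ : V => uniformOn (Set.univ : Set (Fin (k n φ))))
      {f | ∀ b, ¬ ∃! u, u ∈ A.filter (fun u => bucketOf n φ (x u) = i x + 1) ∧ f u = b} ≤ c)
    (hi : ∀ x ∉ Bad, i x < a n φ) :
    (Measure.pi fun _ : V => choiceLaw n φ)
      {y | ∀ r < tph n φ, ¬ ∃! u, u ∈ A ∧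
        r = (bucketOf n φ (y u).1 - 1) * k n φ + ((y u).2 : ℕ)} ≤
      (Measure.pi fun _ : V => geometricMeasure
        (Set.projIcc (0 : ℝ) 1 zero_le_one (1 - φ / (n : ℝ) ^ (1 / φ)))) Bad + c := by
  have hmp := measurePreserving_arrowProdEquivProdArrow ℕ (Fin (k n φ)) V
    (fun _ => geometricMeasure (Set.projIcc (0 : ℝ) 1 zero_le_one (1 - φ / (n : ℝ) ^ (1 / φ))))
    (fun _ => uniformOn Set.univ)
  set S : Set ((V → ℕ) × (V → Fin (k n φ))) := {z | ∀ r < tph n φ, ¬ ∃! u, u ∈ A ∧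
    r = (bucketOf n φ (z.1 u) - 1) * k n φ + ((z.2 u : Fin _) : ℕ)} with hS
  have h1 : (Measure.pi fun _ : V => choiceLaw n φ)
      {y | ∀ r < tph n φ, ¬ ∃! u, u ∈ A ∧
        r = (bucketOf n φ (y u).1 - 1) * k n φ + ((y u).2 : ℕ)} =
      (Measure.pi fun _ : V => choiceLaw n φ)
        (MeasurableEquiv.arrowProdEquivProdArrow ℕ (Fin (k n φ)) V ⁻¹' S) := rfl
  rw [h1]
  unfold choiceLaw
  rw [hmp.measure_preimage (MeasurableSet.of_discrete (s := S)).nullMeasurableSet,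
    Measure.prod_apply (MeasurableSet.of_discrete (s := S))]
  -- Condition on the bucket numbers `x`. Outside `Bad`, failure of the phase implies failure of
  -- bucket `i x + 1` alone.
  calc _ ≤ ∫⁻ x, Bad.indicator 1 x + c ∂(Measure.pi fun _ : V => geometricMeasure
        (Set.projIcc (0 : ℝ) 1 zero_le_one (1 - φ / (n : ℝ) ^ (1 / φ)))) := by
        refine lintegral_mono fun x => ?_
        by_cases hx : x ∈ Bad
        · rw [Set.indicator_of_mem hx]
          exact prob_le_one.trans le_self_add
        · refine le_add_left (le_trans (measure_mono ?_) (hc x hx))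
          intro f hf b hex
          have hk : (b : ℕ) < k n φ := b.2
          refine hf (i x * k n φ + b) ?_ ?_
          · have : (i x + 1) * k n φ ≤ a n φ * k n φ := Nat.mul_le_mul_right _ (hi x hx)
            unfold tph
            rw [add_mul] at this
            omega
          · have hiff : ∀ u, (u ∈ A ∧ i x * k n φ + b =
                (bucketOf n φ (x u) - 1) * k n φ + ((f u : Fin _) : ℕ)) ↔
                (u ∈ A.filter (fun u => bucketOf n φ (x u) = i x + 1) ∧ f u = b) := by
              intro u
              have hf2 : ((f u : Fin _) : ℕ) < k n φ := (f u).2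
              have hb : 0 < bucketOf n φ (x u) := lt_min (Nat.succ_pos _) ha
              rw [Finset.mem_filter, and_assoc]
              refine and_congr_right fun _ => ?_
              constructor
              · intro h
                -- Quotient and remainder by `k` recover the bucket and the slot from the round.
                have hd := congrArg (· / k n φ) h
                have hm := congrArg (· % k n φ) h
                simp only [Nat.mul_add_mod', Nat.mod_eq_of_lt hk, Nat.mod_eq_of_lt hf2] at hm
                simp only [mul_comm _ (k n φ), Nat.mul_add_div (k_pos n φ),
                  Nat.div_eq_of_lt hk, Nat.div_eq_of_lt hf2, add_zero] at hd
                exact ⟨by omega, Fin.ext hm.symm⟩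
              · rintro ⟨h, h'⟩
                rw [h, h', Nat.add_sub_cancel]
            simpa only [hiff] using hex
    _ = _ := by
      rw [lintegral_add_right _ measurable_const, lintegral_indicator_one
        MeasurableSet.of_discrete]
      simp

lemma measure_fail_few_le (hn : 4 ≤ n) (h1 : 1 ≤ φ)
    (h2 : φ < Real.logb 2 n / Real.logb 2 (Real.logb 2 n)) {A : Finset V} (hA : A.Nonempty)
    (hAk : 4 * A.card ≤ k n φ) :
    (Measure.pi fun _ : V => choiceLaw n φ)
      {y | ∀ r < tph n φ, ¬ ∃! u, u ∈ A ∧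
        r = (bucketOf n φ (y u).1 - 1) * k n φ + ((y u).2 : ℕ)} ≤
      ENNReal.ofReal (1 / (n : ℝ) ^ (1 / φ)) := by
  classical
  have ha := a_pos hn h1 h2
  obtain ⟨u₀, hu₀⟩ := hA
  have hb : ∀ x, 0 < bucketOf n φ x := fun x => lt_min (Nat.succ_pos _) ha
  refine (choiceLaw_fail_le (c := ENNReal.ofReal (1 / (n : ℝ) ^ (1 / φ))) (Bad := ∅) ha
    (fun x => bucketOf n φ (x u₀) - 1) (fun x _ => ?_) fun x _ => ?_).trans (by simp)
  · refine (BallsIntoBins.measure_not_existsUnique_few_le ⟨u₀, ?_⟩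
      ((Nat.mul_le_mul_left 4 (Finset.card_filter_le _ _)).trans hAk)).trans
      (ENNReal.ofReal_le_ofReal ?_)
    · have := hb (x u₀)
      exact Finset.mem_filter.2 ⟨hu₀, by omega⟩
    · have hk := le_k n φ
      have hN : 0 < (n : ℝ) ^ (1 / φ) := by positivity
      rw [div_le_div_iff₀ (by linarith) hN]
      linarith
  · have := hb (x u₀)
    have h3 : bucketOf n φ (x u₀) ≤ a n φ := min_le_right _ _
    omega

/-- The chosen bucket is empty, holds more than 8N ln N stations, or has no singleton slot: three
events of probability at most 1/(4N) each. -/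
lemma measure_fail_many_le (hn : 4 ≤ n) (h1 : 1 ≤ φ)
    (h2 : φ < Real.logb 2 n / Real.logb 2 (Real.logb 2 n)) {A : Finset V} (hAn : A.card < n)
    (hAk : k n φ < 4 * A.card) :
    (Measure.pi fun _ : V => choiceLaw n φ)
      {y | ∀ r < tph n φ, ¬ ∃! u, u ∈ A ∧
        r = (bucketOf n φ (y u).1 - 1) * k n φ + ((y u).2 : ℕ)} ≤
      ENNReal.ofReal (1 / (n : ℝ) ^ (1 / φ)) := by
  classical
  have ha := a_pos hn h1 h2
  have hqa := pow_a_le hn h1 h2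
  have hLN := logb_lt_rpow hn h1 h2
  have hk := le_k n φ
  have hAk' : (k n φ : ℝ) < 4 * A.card := by exact_mod_cast hAk
  have hAn' : (A.card : ℝ) < n := by exact_mod_cast hAn
  -- From 24N ≤ k < 4m < 4n and log n < N follows 6 log n < n. Then n > 16 gives N ≥ 4 and q ≤ 1/2.
  have hn16 : 16 < n := sixteen_lt hn (by linarith)
  have hL := four_le_logb hn16
  have hq2 := div_rpow_le_half hn16 h1 h2
  set N := (n : ℝ) ^ (1 / φ) with hN_def
  set q := φ / N with hq_def
  set m : ℝ := (A.card : ℝ) with hm_def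
  have hN : 4 ≤ N := by linarith
  have hN0 : 0 < N := by linarith
  have hq0 : 0 < q := by positivity
  have hn0 : (0 : ℝ) < n := by positivity
  have hm : 6 * N < m := by linarith
  have hlog1 : 1 ≤ Real.log N := by
    rw [Real.le_log_iff_exp_le hN0]
    linarith [Real.exp_one_lt_d9]
  have hlogN : Real.log N ≤ N := (Real.log_le_sub_one_of_pos hN0).trans (by linarith)
  have hN4 : 4 * N ≤ N * N := mul_le_mul_of_nonneg_right hN hN0.le
  have hexp2 : Real.exp (-(2 * Real.log N)) ≤ 1 / (4 * N) := by
    rw [Real.exp_neg, two_mul, Real.exp_add, Real.exp_log hN0, ← one_div]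
    exact one_div_le_one_div_of_le (by positivity) hN4
  set B := 4 * N * Real.log N with hB_def
  have hNB : N ≤ B := by
    have := mul_le_mul_of_nonneg_left hlog1 hN0.le
    linarith
  have hlast : m * q ^ (a n φ - 1) ≤ B := by
    have h3 : m * q ^ a n φ ≤ 1 := by
      calc m * q ^ a n φ ≤ n * (1 / n) := by gcongr
        _ = 1 := by field_simp
    have h4 : q ^ a n φ = q ^ (a n φ - 1) * q := by rw [← pow_succ, Nat.sub_add_cancel ha]
    rw [h4, ← mul_assoc, ← le_div_iff₀ hq0] at h3
    calc _ ≤ 1 / q := h3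
      _ = N / φ := by rw [hq_def, one_div_div]
      _ ≤ N := div_le_self hN0.le h1
      _ ≤ B := hNB
  have hex : ∃ l, m * q ^ l ≤ B := ⟨_, hlast⟩
  -- The first bucket that at most `B` stations are expected to reach; `hlast` shows that it comes
  -- no later than the last one.
  set l := Nat.find hex with hl_def
  have hlB : m * q ^ l ≤ B := Nat.find_spec hex
  have hla : l < a n φ := by
    have := Nat.find_min' hex hlast
    omega
  have hlow : 2 * Real.log N ≤ m * (q ^ l * (1 - q)) := by
    have hhalf : m * q ^ l * (1 / 2) ≤ m * (q ^ l * (1 - q)) := by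
      rw [← mul_assoc]
      gcongr
      linarith
    refine le_trans ?_ hhalf
    -- For l = 0 there are more than 6N stations. Otherwise minimality gives m q^l ≥ B q = 4φ ln N.
    rcases Nat.eq_zero_or_pos l with h0 | h0
    · rw [h0, pow_zero, mul_one]; linarith
    · have h3 : B < m * q ^ (l - 1) := by
        have := Nat.find_min hex (m := l - 1) (by omega)
        linarith
      have h4 : q ^ l = q ^ (l - 1) * q := by rw [← pow_succ, Nat.sub_add_cancel h0]
      have h5 : B * q = 4 * Real.log N * φ := by rw [hB_def, hq_def]; field_simp
      have h6 : B * q ≤ m * q ^ l := by rw [h4, ← mul_assoc]; gcongr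
      have := mul_le_mul_of_nonneg_left h1 (zero_le_one.trans hlog1)
      linarith
  set pr : unitInterval := Set.projIcc (0 : ℝ) 1 zero_le_one (1 - q) with hpr_def
  have hpr : (pr : ℝ) = 1 - q := by
    rw [hpr_def, Set.projIcc_of_mem zero_le_one (⟨by linarith, by linarith⟩ : _ ∈ Set.Icc _ _)]
  have hpr0 : pr ≠ 0 := by
    intro h
    rw [h] at hpr
    simp at hpr
    linarith
  have hpr1 : (1 - pr : ℝ) = q := by rw [hpr]; ring
  set Q : Set ℕ := {x | bucketOf n φ x = l + 1} with hQ_def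
  -- The last bucket also collects the whole tail, so only {l} ⊆ Q ⊆ [l, ∞) holds in general.
  have hQlow : ENNReal.ofReal (q ^ l * (1 - q)) ≤ geometricMeasure pr Q := by
    calc _ = geometricMeasure pr {l} := by
          rw [geometricMeasure_singleton hpr0, hpr1, hpr]
      _ ≤ _ := measure_mono fun x hx => by
          rw [Set.mem_singleton_iff.1 hx]
          exact min_eq_left (by omega)
  have hQup : geometricMeasure pr Q ≤ ENNReal.ofReal (q ^ l) := by
    calc _ ≤ geometricMeasure pr (Set.Ici l) := measure_mono fun x hx => by
          have hx' : min (x + 1) (a n φ) = l + 1 := hx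
          have := min_le_left (x + 1) (a n φ)
          exact Set.mem_Ici.2 (by omega)
      _ ≤ _ := by
          rw [← hpr1]; exact geometricMeasure_Ici_le hpr0 l
  have hempty := measure_pi_forall_notMem_le (MeasurableSet.of_discrete (s := Q)) hQlow A
  have hmany := measure_pi_lt_card_le (MeasurableSet.of_discrete (s := Q)) (by positivity) hQup A
    (2 * B)
  rw [← hm_def] at hempty hmany
  set E1 : Set (V → ℕ) := {x | ∀ u ∈ A, x u ∉ Q}
  obtain ⟨E2, hE2_def⟩ : ∃ E2 : Set (V → ℕ), ∀ x, x ∈ E2 ↔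
      2 * B < ((A.filter fun u => bucketOf n φ (x u) = l + 1).card : ℝ) :=
    ⟨{x | 2 * B < ((A.filter fun u => bucketOf n φ (x u) = l + 1).card : ℝ)}, fun _ => Iff.rfl⟩
  have hE1 : (Measure.pi fun _ : V => geometricMeasure pr) E1 ≤
      ENNReal.ofReal (1 / (4 * N)) := by
    refine hempty.trans (ENNReal.ofReal_le_ofReal (le_trans ?_ hexp2))
    exact Real.exp_le_exp.2 (by linarith)
  have hE2 : (Measure.pi fun _ : V => geometricMeasure pr) E2 ≤
      ENNReal.ofReal (1 / (4 * N)) := by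
    -- Since m q^l ≤ B, the exponent is at most -B/4 = -N ln N ≤ -2 ln N.
    have h3 : Real.exp (2 * (m * q ^ l) * (7 / 8) - 2 * B) ≤ 1 / (4 * N) := by
      refine le_trans (Real.exp_le_exp.2 ?_) hexp2
      have := mul_le_mul_of_nonneg_right hN (zero_le_one.trans hlog1)
      linarith
    refine (measure_mono fun x hx => ?_).trans (hmany.trans (ENNReal.ofReal_le_ofReal h3))
    have h4 := (hE2_def x).1 hx
    change 2 * B < _
    convert h4
    rfl
  refine (choiceLaw_fail_le (c := ENNReal.ofReal (1 / (4 * N))) (Bad := E1 ∪ E2) ha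
    (fun _ => l) (fun x hx => ?_) fun x _ => hla).trans ?_
  · obtain ⟨hx1, hx2⟩ := not_or.1 hx
    refine BallsIntoBins.measure_not_existsUnique_many_le ?_ hN hk ?_
    · by_contra hne
      refine hx1 fun u hu huQ => hne ⟨u, Finset.mem_filter.2 ⟨hu, huQ⟩⟩
    · have hx3 := not_lt.1 (mt (hE2_def x).2 hx2)
      refine le_trans (le_of_eq ?_) (hx3.trans (le_of_eq (by rw [hB_def]; ring)))
      congr 2
  · calc _ ≤ ENNReal.ofReal (1 / (4 * N)) + ENNReal.ofReal (1 / (4 * N)) +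
          ENNReal.ofReal (1 / (4 * N)) := by
          gcongr
          exact (measure_union_le _ _).trans (add_le_add hE1 hE2)
      _ = ENNReal.ofReal (3 / (4 * N)) := by
          rw [← ENNReal.ofReal_add (by positivity) (by positivity),
            ← ENNReal.ofReal_add (by positivity) (by positivity)]
          congr 1; ring
      _ ≤ _ := by
          refine ENNReal.ofReal_le_ofReal ?_
          rw [div_le_div_iff₀ (by positivity) hN0]
          linarith

/-- A station with an active neighbour receives the message in a phase with high probability. -/
lemma law_phaseStep_eq_none_le (hn : 4 ≤ n) (h1 : 1 ≤ φ)
    (h2 : φ < Real.logb 2 n / Real.logb 2 (Real.logb 2 n)) (hV : Fintype.card V = n)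
    (G : SimpleGraph V) (σ : V → Option ℕ) (w : V) (hw : σ w = none)
    (hu : ∃ u, G.Adj w u ∧ ∃ j : Fin (reps n φ ε), σ u = some j.val) :
    law V n φ ε {ω | phaseStep G ω σ w = none} ≤ ENNReal.ofReal (1 / (n : ℝ) ^ (1 / φ)) := by
  classical
  set A : Finset V := Finset.univ.filter fun u => G.Adj w u ∧
    ∃ j : Fin (reps n φ ε), σ u = some j.val with hA_def
  have hA : A.Nonempty := by
    obtain ⟨u, hu⟩ := hu
    exact ⟨u, Finset.mem_filter.2 ⟨Finset.mem_univ _, hu⟩⟩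
  have hAn : A.card < n := by
    rw [← hV]
    refine Finset.card_lt_univ_of_notMem (x := w) fun hwA => ?_
    exact G.loopless.irrefl w (Finset.mem_filter.1 hwA).2.1
  obtain ⟨-, -, j₀, -⟩ := hu
  -- Stations outside `A` get the dummy index `j₀`, so that one choice per station can be projected
  -- from the seeds.
  have hi : ∀ u, ∃ j : Fin (reps n φ ε), u ∈ A → σ u = some j.val := by
    intro u
    by_cases hu : u ∈ A
    · obtain ⟨j, hj⟩ := (Finset.mem_filter.1 hu).2.2
      exact ⟨j, fun _ => hj⟩
    · exact ⟨j₀, fun h => absurd h hu⟩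
  choose i hi using hi
  have hmp : MeasurePreserving (fun (ω : V → Seed n φ ε) u => ω u (i u)) (law V n φ ε)
      (Measure.pi fun _ => choiceLaw n φ) :=
    measurePreserving_pi (fun _ => seedLaw n φ ε) (fun _ => choiceLaw n φ)
      (f := fun u (ω : Seed n φ ε) => ω (i u)) fun u => measurePreserving_eval _ (i u)
  have hset : ({ω | phaseStep G ω σ w = none} : Set (V → Seed n φ ε)) ⊆
      (fun (ω : V → Seed n φ ε) u => ω u (i u)) ⁻¹'
        {y | ∀ r < tph n φ, ¬ ∃! u, u ∈ A ∧
          r = (bucketOf n φ (y u).1 - 1) * k n φ + ((y u).2 : ℕ)} := by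
    intro ω hω r hr hex
    have hω' : phaseStep G ω σ w = none := hω
    unfold phaseStep at hω'
    rw [hw] at hω'
    simp only [ite_eq_right_iff, reduceCtorEq, imp_false] at hω'
    refine hω' ⟨r, hr, ?_⟩
    have hiff : ∀ u, (u ∈ A ∧ r = (bucketOf n φ (ω u (i u)).1 - 1) * k n φ +
        ((ω u (i u)).2 : ℕ)) ↔ G.Adj w u ∧ Sends σ ω u r := by
      intro u
      constructor
      · rintro ⟨hu, hr⟩
        exact ⟨(Finset.mem_filter.1 hu).2.1, i u, hi u hu, hr⟩
      · rintro ⟨hadj, j, hj, hr⟩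
        have hu : u ∈ A := Finset.mem_filter.2 ⟨Finset.mem_univ _, hadj, j, hj⟩
        refine ⟨hu, ?_⟩
        have hij := (hi u hu).symm.trans hj
        rw [Fin.ext (Option.some.inj hij)]
        exact hr
    simpa only [hiff] using hex
  refine (measure_mono hset).trans ?_
  rw [hmp.measure_preimage (MeasurableSet.of_discrete).nullMeasurableSet]
  rcases le_or_gt (4 * A.card) (k n φ) with h | h
  · exact measure_fail_few_le hn h1 h2 hA h
  · exact measure_fail_many_le hn h1 h2 hAn h

end Phase

end GGB

namespace GGB

/-! ### Broadcasting time -/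

section Time

variable {V : Type*} [Fintype V] {n : ℕ} {φ ε : ℝ}

lemma missPotential_phaseStart_le (G : SimpleGraph V) (o : V) (R : ℕ) (s : ENNReal) (v : V) :
    missPotential G R s (phaseStart o) v ≤ (s ^ 2) ^ R := by
  classical
  have h : oldest G (phaseStart o) v = 0 := by
    refine Nat.eq_zero_of_le_zero (Finset.sup_le fun u _ => ?_)
    unfold phaseStart
    split_ifs <;> simp
  unfold missPotential
  rw [h, Nat.sub_zero]
  split_ifs
  · exact le_rfl
  · exact zero_le

lemma slowPotential_phaseStart_le {G : SimpleGraph V} (hG : G.Connected) (o : V) {s β : ENNReal}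
    (hβ : 1 ≤ β) (p : ℕ) (v : V) :
    slowPotential G s β p (phaseStart o) v ≤ β ^ G.diam * s ^ p := by
  classical
  have : Nonempty V := ⟨o⟩
  unfold slowPotential
  split_ifs
  · refine mul_le_mul_left (pow_le_pow_right₀ hβ ?_) _
    exact (distInformed_le (u := o) (by simp [phaseStart]) v).trans
      (SimpleGraph.dist_le_diam (SimpleGraph.connected_iff_ediam_ne_top.1 hG))
  · exact zero_le

/-- This fixes the number of iterations: N^(-R) ≤ ε/(2n) leaves room for two potentials at each of n
stations. -/
lemma le_rpow_pow_reps (hn : 4 ≤ n) (h1 : 1 ≤ φ) (hε : 0 < ε) :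
    2 * n / ε ≤ ((n : ℝ) ^ (1 / φ)) ^ reps n φ ε := by
  have hn0 : (0 : ℝ) < n := by positivity
  have hL := two_le_logb hn
  have hR : φ * (1 + Real.logb 2 (2 / ε) / Real.logb 2 n) ≤ reps n φ ε := Nat.le_ceil _
  rw [← Real.logb_le_logb (b := 2) (by norm_num) (by positivity) (by positivity), Real.logb_pow,
    logb_rpow_one_div hn]
  have h2 : 2 * (n : ℝ) / ε = n * (2 / ε) := by ring
  rw [h2, Real.logb_mul hn0.ne' (by positivity), ← mul_div_assoc, le_div_iff₀ (by linarith)]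
  calc _ = φ * (1 + Real.logb 2 (2 / ε) / Real.logb 2 n) * Real.logb 2 n := by
        field_simp
    _ ≤ _ := by gcongr

lemma law_exists_uninformed_le_ofReal (hn : 4 ≤ n) (h1 : 1 ≤ φ)
    (h2 : φ < Real.logb 2 n / Real.logb 2 (Real.logb 2 n)) (hε : 0 < ε)
    (hV : Fintype.card V = n) {G : SimpleGraph V} (hG : G.Connected) (o : V) :
    law V n φ ε {ω | ∃ v, (phaseStep G ω)^[5 * G.diam + 2 * reps n φ ε] (phaseStart o) v = none} ≤
      ENNReal.ofReal ε := by
  have hN : 2 ≤ (n : ℝ) ^ (1 / φ) := (two_le_logb hn).trans (logb_lt_rpow hn h1 h2).le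
  have hpow := le_rpow_pow_reps hn h1 hε
  have hn0 : (0 : ℝ) < n := by positivity
  set R := reps n φ ε
  have hfail := law_phaseStep_eq_none_le (ε := ε) hn h1 h2 hV G
  set N := (n : ℝ) ^ (1 / φ)
  have hN0 : 0 < N := by linarith
  set t := √(1 / N) with ht_def
  have ht0 : 0 < t := Real.sqrt_pos.2 (by positivity)
  have ht2 : t ^ 2 = 1 / N := Real.sq_sqrt (by positivity)
  have ht2' : t ^ 2 ≤ 1 / 2 := by
    rw [ht2]; exact one_div_le_one_div_of_le (by norm_num) hN
  have ht34 : t ≤ 3 / 4 := by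
    by_contra h
    push Not at h
    nlinarith
  have ht4 : t ^ 4 ≤ 1 / 4 := by
    have : t ^ 4 = t ^ 2 * t ^ 2 := by ring
    rw [this]; nlinarith [sq_nonneg t]
  set s := ENNReal.ofReal t with hs_def
  -- With β = t^(-5), the condition `hβ` becomes t^4 + t ≤ 1, which N ≥ 2 guarantees as 1/4 + 3/4.
  -- The exponent 5 is the number of phases paid per unit of distance.
  set β := ENNReal.ofReal ((t ^ 5)⁻¹) with hβ_def
  have hs2 : s ^ 2 = ENNReal.ofReal (1 / N) := by rw [hs_def, ← ENNReal.ofReal_pow ht0.le, ht2]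
  have hs1 : s ≤ 1 := ENNReal.ofReal_le_one.2 (by linarith)
  have hβ1 : 1 ≤ β := by
    rw [hβ_def, ENNReal.one_le_ofReal]
    exact one_le_inv_iff₀.2 ⟨by positivity, pow_le_one₀ ht0.le (by linarith)⟩
  have hβs : β * s ^ 5 = 1 := by
    rw [hβ_def, hs_def, ← ENNReal.ofReal_pow ht0.le, ← ENNReal.ofReal_mul (by positivity),
      inv_mul_cancel₀ (by positivity), ENNReal.ofReal_one]
  have hβ : 1 + s ^ 2 * β ≤ β * s := by
    rw [hs_def, hβ_def, ← ENNReal.ofReal_pow ht0.le, ← ENNReal.ofReal_mul (by positivity),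
      ← ENNReal.ofReal_mul (by positivity), ← ENNReal.ofReal_one,
      ← ENNReal.ofReal_add (by norm_num) (by positivity)]
    refine ENNReal.ofReal_le_ofReal ?_
    have h3 : 1 + t ^ 2 * (t ^ 5)⁻¹ = (t ^ 5)⁻¹ * t * (t ^ 4 + t) := by field_simp
    rw [h3]
    exact mul_le_of_le_one_right (by positivity) (by linarith)
  refine (law_exists_uninformed_le hG hs1 hβ1 hβ
    (fun σ w hw hu => hs2 ▸ hfail σ w hw hu) _ ⟨o, by simp [phaseStart]⟩).trans ?_
  have hterm : ∀ v, missPotential G R s (phaseStart o) v +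
      slowPotential G s β (5 * G.diam + 2 * R) (phaseStart o) v ≤ ENNReal.ofReal (ε / n) := by
    intro v
    have h3 : β ^ G.diam * s ^ (5 * G.diam + 2 * R) = (s ^ 2) ^ R := by
      rw [pow_add, pow_mul, pow_mul, ← mul_assoc, ← mul_pow, hβs, one_pow, one_mul]
    calc _ ≤ (s ^ 2) ^ R + (s ^ 2) ^ R := add_le_add (missPotential_phaseStart_le G o R s v)
          (h3 ▸ slowPotential_phaseStart_le hG o hβ1 _ v)
      _ = ENNReal.ofReal (2 * (1 / N) ^ R) := by
          rw [hs2, ← ENNReal.ofReal_pow (by positivity),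
            ← ENNReal.ofReal_add (by positivity) (by positivity), two_mul]
      _ ≤ _ := by
          refine ENNReal.ofReal_le_ofReal ?_
          rw [div_le_iff₀ hε] at hpow
          rw [one_div_pow, mul_one_div, div_le_div_iff₀ (by positivity) hn0]
          linarith
  calc _ ≤ ∑ _v : V, ENNReal.ofReal (ε / n) := Finset.sum_le_sum fun v _ => hterm v
    _ = ENNReal.ofReal ε := by
      rw [Finset.sum_const, Finset.card_univ, hV, ← ENNReal.ofReal_nsmul, nsmul_eq_mul,
        mul_div_cancel₀ _ hn0.ne']

lemma reps_le (hn : 4 ≤ n) (h1 : 1 ≤ φ) (hε : 2 / (n : ℝ) ^ 3 < ε) :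
    (reps n φ ε : ℝ) ≤ 5 * φ := by
  have hn0 : (0 : ℝ) < n := by positivity
  have hε0 : 0 < ε := lt_trans (by positivity) hε
  have hL := two_le_logb hn
  have h3 : Real.logb 2 (2 / ε) ≤ 3 * Real.logb 2 n := by
    have h4 : Real.logb 2 ((n : ℝ) ^ 3) = 3 * Real.logb 2 n := by
      rw [Real.logb_pow]; norm_num
    rw [← h4]
    refine Real.logb_le_logb_of_le (by norm_num) (by positivity) ?_
    rw [div_lt_iff₀ (by positivity)] at hε
    rw [div_le_iff₀ hε0]
    linarith
  have h5 : φ * (1 + Real.logb 2 (2 / ε) / Real.logb 2 n) ≤ 4 * φ := by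
    have : Real.logb 2 (2 / ε) / Real.logb 2 n ≤ 3 := by
      rw [div_le_iff₀ (by linarith)]; exact h3
    calc _ ≤ φ * (1 + 3) := by gcongr
      _ = _ := by ring
  have h6 : (reps n φ ε : ℝ) ≤ ⌈4 * φ⌉₊ := by exact_mod_cast Nat.ceil_mono h5
  have h7 := Nat.ceil_lt_add_one (a := 4 * φ) (by linarith)
  linarith

lemma tph_le (hn : 4 ≤ n) (h1 : 1 ≤ φ)
    (h2 : φ < Real.logb 2 n / Real.logb 2 (Real.logb 2 n)) :
    (tph n φ : ℝ) ≤ 98 * ((n : ℝ) ^ (1 / φ) *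
      (φ * Real.logb 2 n / (Real.logb 2 n - φ * Real.logb 2 φ))) := by
  have hN : 2 ≤ (n : ℝ) ^ (1 / φ) := (two_le_logb hn).trans (logb_lt_rpow hn h1 h2).le
  have hA := h1.trans (le_phase_length hn h1 h2)
  set N := (n : ℝ) ^ (1 / φ)
  set A := φ * Real.logb 2 n / (Real.logb 2 n - φ * Real.logb 2 φ)
  have ha : (a n φ : ℝ) ≤ 2 * A := by
    have : (a n φ : ℝ) < A + 1 := Nat.ceil_lt_add_one (by linarith)
    linarith
  have hk : (k n φ : ℝ) ≤ 49 * N := by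
    have h3 := Nat.ceil_lt_add_one (a := N) (by linarith)
    have h4 : (k n φ : ℝ) = 24 * (⌈N⌉₊ : ℝ) + 1 := by unfold k; push_cast; rfl
    linarith
  unfold tph
  push_cast
  calc _ ≤ 2 * A * (49 * N) := by gcongr
    _ = _ := by ring

/-- As φ ≤ log n, the term φ log φ is at most φ log log n ≤ (log n)/2, so the denominator keeps half
of log n. -/
lemma phase_length_le (hn : 4 ≤ n) (h1 : 1 ≤ φ)
    (h2 : φ < Real.logb 2 n / Real.logb 2 (Real.logb 2 n))
    (h3 : φ ≤ Real.logb 2 n / (2 * Real.logb 2 (Real.logb 2 n))) :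
    φ * Real.logb 2 n / (Real.logb 2 n - φ * Real.logb 2 φ) ≤ 2 * φ := by
  have hL := two_le_logb hn
  have hLL := one_le_logb_logb hn
  have hφL : φ ≤ Real.logb 2 n := h2.le.trans (div_le_self (by linarith) hLL)
  have h4 := Real.logb_le_logb_of_le (b := 2) (by norm_num) (by linarith) hφL
  have h5 : φ * Real.logb 2 φ ≤ φ * Real.logb 2 (Real.logb 2 n) := by gcongr
  rw [le_div_iff₀ (by linarith)] at h3
  rw [div_le_iff₀ (logb_sub_pos hn h1 h2), mul_comm 2 φ, mul_assoc]
  gcongr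
  linarith

lemma ofReal_le_law_completesWithin (hn : 4 ≤ n) (h1 : 1 ≤ φ)
    (h2 : φ < Real.logb 2 n / Real.logb 2 (Real.logb 2 n)) (hε : 2 / (n : ℝ) ^ 3 < ε)
    (hV : Fintype.card V = n) {G : SimpleGraph V} (hG : G.Connected) (o : V) {T : ℝ}
    (hT : 1470 * (((G.diam : ℝ) + φ) * (n : ℝ) ^ (1 / φ) *
      (φ * Real.logb 2 n / (Real.logb 2 n - φ * Real.logb 2 φ))) ≤ T) :
    ENNReal.ofReal (1 - ε) ≤
      law V n φ ε {ω | (protocol n φ ε).CompletesWithin G o ω T} := by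
  have hε0 : 0 < ε := lt_trans (by positivity) hε
  set Bad : Set (V → Seed n φ ε) :=
    {ω | ∃ v, (phaseStep G ω)^[5 * G.diam + 2 * reps n φ ε] (phaseStart o) v = none}
  have hBad : law V n φ ε Bad ≤ ENNReal.ofReal ε :=
    law_exists_uninformed_le_ofReal hn h1 h2 hε0 hV hG o
  calc ENNReal.ofReal (1 - ε) = 1 - ENNReal.ofReal ε := by
        rw [ENNReal.ofReal_sub _ hε0.le, ENNReal.ofReal_one]
    _ ≤ 1 - law V n φ ε Bad := tsub_le_tsub_left hBad 1
    _ = law V n φ ε Badᶜ := (prob_compl_eq_one_sub (measurableSet_seeds _)).symm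
    _ ≤ _ := by
      refine measure_mono fun ω hω => ⟨_, ?_, completedBy (a_pos hn h1 h2) G o ω
        (5 * G.diam + 2 * reps n φ ε) fun v hv => hω ⟨v, hv⟩⟩
      refine le_trans ?_ hT
      have hR := reps_le hn h1 hε
      have ht := tph_le hn h1 h2
      have hN : 0 < (n : ℝ) ^ (1 / φ) := by positivity
      have hA := h1.trans (le_phase_length hn h1 h2)
      push_cast
      -- There are 5D + 3R phases and R ≤ 5φ, which gives 15(D + φ); 15 · 98 = 1470.
      calc _ ≤ (15 * ((G.diam : ℝ) + φ)) * (98 * ((n : ℝ) ^ (1 / φ) *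
            (φ * Real.logb 2 n / (Real.logb 2 n - φ * Real.logb 2 φ)))) := by
            gcongr
            have : (0 : ℝ) ≤ G.diam := Nat.cast_nonneg _
            linarith
        _ = _ := by ring

end Time

end GGB

theorem mainTheorem1 :
    ∃ C : ℝ, 0 < C ∧
      ∀ (V : Type*) [Fintype V] (G : SimpleGraph V) (o : V) (n : ℕ) (φ ε : ℝ),
        G.Connected → Fintype.card V = n → 4 ≤ n →
        1 ≤ φ → φ < Real.logb 2 n / Real.logb 2 (Real.logb 2 n) → 2 / (n : ℝ) ^ 3 < ε →
        -- energy, in every execution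
        (∀ (ω : V → GGB.Seed n φ ε) (v : V),
          (GGB.protocol n φ ε).energy G o ω v ≤
            (⌈φ * (1 + Real.logb 2 (2 / ε) / Real.logb 2 n)⌉₊ : ℕ∞)) ∧
        -- time
        ENNReal.ofReal (1 - ε) ≤
          GGB.law V n φ ε {ω | (GGB.protocol n φ ε).CompletesWithin G o ω
            (C * (((G.diam : ℝ) + φ) * (n : ℝ) ^ (1 / φ) *
              (φ * Real.logb 2 n / (Real.logb 2 n - φ * Real.logb 2 φ))))} ∧
        -- time for smaller energy limits
        (φ ≤ Real.logb 2 n / (2 * Real.logb 2 (Real.logb 2 n)) →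
          ENNReal.ofReal (1 - ε) ≤
            GGB.law V n φ ε {ω | (GGB.protocol n φ ε).CompletesWithin G o ω
              (C * (((G.diam : ℝ) + φ) * (n : ℝ) ^ (1 / φ) * φ))}) := by
  -- Twice 1470, the factor 2 being needed for `phase_length_le` in the last claim.
  refine ⟨2940, by norm_num, fun V _ G o n φ ε hG hV hn h1 h2 hε => ⟨fun ω v => ?_, ?_, ?_⟩⟩
  · exact GGB.energy_le (GGB.a_pos hn h1 h2) G o ω v
  · refine GGB.ofReal_le_law_completesWithin hn h1 h2 hε hV hG o ?_
    have hA := h1.trans (GGB.le_phase_length hn h1 h2)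
    gcongr
    norm_num
  · intro h3
    refine GGB.ofReal_le_law_completesWithin hn h1 h2 hε hV hG o ?_
    have hA := GGB.phase_length_le hn h1 h2 h3
    calc _ ≤ 1470 * (((G.diam : ℝ) + φ) * (n : ℝ) ^ (1 / φ) * (2 * φ)) := by gcongr
      _ = _ := by ring
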